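/- **Setting.** Let $m\ge 2$. On $\mathbb R^{n}_s$ put $\langle X,Y\rangle_s=-\sum_{i\le s}X_iY_i+\sum_{i>s}X_iY_i$. Let $\mathbb Q^{m+1}_1=\{[y]\in\mathbb{RP}^{m+2}:\langle y,y\rangle_2=0\}$ and $\mathbb S^{m+1}_1=\{x\in\mathbb R^{m+2}_1:\langle x,x\rangle_1=1\}$. For $\alpha=1,2$ let $U_\alpha=\{[y]\in\mathbb Q^{m+1}_1: y_\alpha\ne0\}$ and, writing $y=(y_1,y_2,y_3)\in\mathbb R\times\mathbb R\times\mathbb R^{m+1}$, define $\Psi^{(\alpha)}:U_\alpha\to\mathbb S^{m+1}_1$ by $$\Psi^{(1)}([y])=y_1^{-1}(y_2,y_3),\qquad \Psi^{(2)}([y])=y_2^{-1}(y_1,y_3).$$ **Invariants of a pair $(Y,\xi)$.** For a smooth map $Y$ from an $m$-manifold to $\mathbb R^{m+3}_2$ inducing a Riemannian metric $\langle dY,dY\rangle_2$ with Laplacian $\Delta$, put $N=-\frac1m\Delta Y-\frac1{2m^2}\langle\Delta Y,\Delta Y\rangle_2Y$. For a smooth field $\xi$ along $Y$ define $$\Phi=-\langle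 \xi,dN\rangle_2,\qquad A=-\langle d^2Y,N\rangle_2,\qquad B=-\langle d^2Y,\xi\rangle_2 .$$ In the two cases below, $N$ and $\xi$ are orthogonal to the image of $dY$, so $A$ and $B$ are well-defined bilinear forms. **Hypersurfaces of $\mathbb Q^{m+1}_1$.** Let $M$ be a smooth $m$-manifold and $\bar x:M\to\mathbb Q^{m+1}_1$ a smooth map. It is a *regular space-like hypersurface* if, for local smooth lifts $y$ of $\bar x$ to $\{y\in\mathbb R^{m+3}_2:\langle y,y\rangle_2=0,\ y\neq0\}$, the form $\langle dy,dy\rangle_2$ is positive definite and the *conformal metric* $$g=-\big(\langle\Delta y,\Delta y\rangle_2-m^2\kappa\big)\langle dy,dy\rangle_2$$ is non-degenerate, where $\Delta$ and $\kappa$ are the Laplacian and the normalized scalar curvature of $\langle dy,dy\rangle_2$; $g$ does not depend on $y$. A *canonical lift* on an open set $V\subset M$ is a smooth lift $Y$ on $V$ with $\langle dY,dY\rangle_2=g$. A *conformal unit normal* is a smooth field $\xi$ along $Y$ with $\langle\xi,\xi\rangle_2=-1$ that is orthogonal to $Y$, $N$ and the image of $dY$. Then $\Phi,A,B$ of $\bar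 x$ are those of $(Y,\xi)$. **Hypersurfaces of $\mathbb S^{m+1}_1$.** Let $x$ be a smooth space-like hypersurface of $\mathbb S^{m+1}_1$ with smooth time-like unit normal field $n$, second fundamental form $h=-\langle d^2x,n\rangle_1$, mean curvature $H=\frac1m\operatorname{tr}h$ and $\rho^2=\frac m{m-1}(|h|^2-mH^2)$. It is *regular* if $\rho^2>0$ everywhere. Its conformal position is $Y=\rho(1,x)$ with $\rho>0$, its conformal metric is $\langle dY,dY\rangle_2$, and its $\Phi,A,B$ are those of $(Y,\xi)$ with $\xi=(-H,-Hx+n)$. **Corollary 2.2.** Let $m\ge2$, let $\bar x:M^m\to\mathbb Q^{m+1}_1$ be a regular space-like hypersurface, and for $\alpha\in\{1,2\}$ let $M^{(\alpha)}=\bar x^{-1}(U_\alpha)$ and $x^{(\alpha)}=\Psi^{(\alpha)}\circ\bar x|_{M^{(\alpha)}}$. Then $M^{(\alpha)}$ is open, $x^{(\alpha)}$ is a regular space-like hypersurface of $\mathbb S^{m+1}_1$, it has a smooth time-like unit normal field on $M^{(\alpha)}$, and the invariants $g,\Phi,A,B$ of $\bar x$ coincide on $M^{(\alpha)}$ with those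 of $x^{(\alpha)}$. Precisely, let $V\subset M^{(\alpha)}$ be open. 1. For every smooth time-like unit normal field $n$ of $x^{(\alpha)}$ on $V$: the conformal metric of $\bar x$, computed from any smooth lift on $V$, equals that of $x^{(\alpha)}$; $\bar x$ has a canonical lift on $V$; and for every canonical lift $Y$ on $V$ the Blaschke tensor $A$ of $\bar x$ equals that of $x^{(\alpha)}$, and there is a conformal unit normal $\xi$ on $V$ for which $\Phi$ and $B$ of $(Y,\xi)$ equal those of $(x^{(\alpha)},n)$. 2. Conversely, for every canonical lift $Y$ and conformal unit normal $\xi$ on $V$ there is a smooth time-like unit normal field $n$ of $x^{(\alpha)}$ on $V$ for which $\Phi$ and $B$ of $(x^{(\alpha)},n)$ equal those of $(Y,\xi)$. -/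

import Mathlib

open scoped Manifold ContDiff

noncomputable section

namespace ConformalGeometry

/-! ### Pseudo-Euclidean spaces -/

/-- The inner product `-X₁·Y₁ + X₂·Y₂` of signature `(s, n - s)` on `ℝⁿ`, the first `s`
coordinates being the time-like ones. -/
def pinner (s : ℕ) {n : ℕ} (X Y : Fin n → ℝ) : ℝ :=
  ∑ i : Fin n, (if (i : ℕ) < s then (-1 : ℝ) else 1) * (X i * Y i)

/-! ### Riemannian geometry in coordinates -/

section Coordinates

variable {m : ℕ} {F : Type*} [NormedAddCommGroup F] [NormedSpace ℝ F]

/-- The partial derivative `∂ᵢ f` at `u`. -/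
def pd (i : Fin m) (f : EuclideanSpace ℝ (Fin m) → F) (u : EuclideanSpace ℝ (Fin m)) : F :=
  fderiv ℝ f u (EuclideanSpace.single i 1)

/-- The Christoffel symbol `Γᵏᵢⱼ` of the metric with coefficient matrix `G`. -/
def christoffel (G : EuclideanSpace ℝ (Fin m) → Matrix (Fin m) (Fin m) ℝ) (k i j : Fin m)
    (u : EuclideanSpace ℝ (Fin m)) : ℝ :=
  1 / 2 * ∑ l, (G u)⁻¹ k l *
    (pd i (fun z => G z j l) u + pd j (fun z => G z i l) u - pd l (fun z => G z i j) u)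

/-- The Laplacian `Gⁱʲ (∂ᵢ∂ⱼ f - Γᵏᵢⱼ ∂ₖ f)` of a vector-valued function. -/
def laplacian (G : EuclideanSpace ℝ (Fin m) → Matrix (Fin m) (Fin m) ℝ)
    (f : EuclideanSpace ℝ (Fin m) → F) (u : EuclideanSpace ℝ (Fin m)) : F :=
  ∑ i, ∑ j, (G u)⁻¹ i j • (pd i (pd j f) u - ∑ k, christoffel G k i j u • pd k f u)

/-- The coefficient `Rˡₖᵢⱼ` in `R(∂ᵢ, ∂ⱼ)∂ₖ = Rˡₖᵢⱼ ∂ₗ`. -/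
def riemannCoeff (G : EuclideanSpace ℝ (Fin m) → Matrix (Fin m) (Fin m) ℝ) (l k i j : Fin m)
    (u : EuclideanSpace ℝ (Fin m)) : ℝ :=
  pd i (christoffel G l j k) u - pd j (christoffel G l i k) u +
    ∑ a, (christoffel G l i a u * christoffel G a j k u -
      christoffel G l j a u * christoffel G a i k u)

/-- The normalized scalar curvature `(m (m - 1))⁻¹ Gʲᵏ Ricⱼₖ`, where `Ricⱼₖ = Rⁱₖᵢⱼ`; it is `1` for
the unit sphere. -/
def normScalarCurvature (G : EuclideanSpace ℝ (Fin m) → Matrix (Fin m) (Fin m) ℝ)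
    (u : EuclideanSpace ℝ (Fin m)) : ℝ :=
  (∑ j, ∑ k, (G u)⁻¹ j k * ∑ i, riemannCoeff G i k i j u) / ((m : ℝ) * ((m : ℝ) - 1))

/-- The coefficient matrix `⟨∂ᵢ f, ∂ⱼ f⟩ₛ` of the form induced by a map `f` into `ℝⁿₛ`. -/
def metricCoeff (s : ℕ) {n : ℕ} (f : EuclideanSpace ℝ (Fin m) → (Fin n → ℝ))
    (u : EuclideanSpace ℝ (Fin m)) : Matrix (Fin m) (Fin m) ℝ :=
  Matrix.of fun i j => pinner s (pd i f u) (pd j f u)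

end Coordinates

section Manifold

variable {m : ℕ} {M : Type*} [TopologicalSpace M] [ChartedSpace (EuclideanSpace ℝ (Fin m)) M]

/-! ### Maps from an `m`-manifold into a pseudo-Euclidean space

Quantities at a point `p` are computed in the preferred chart at `p`, which is also the one through
which Mathlib identifies the tangent space at `p` with `ℝᵐ`. -/

/-- The expression of `f` in the preferred chart at `p`. -/
def inChart {n : ℕ} (f : M → (Fin n → ℝ)) (p : M) : EuclideanSpace ℝ (Fin m) → (Fin n → ℝ) :=
  f ∘ (extChartAt (𝓡 m) p).symm

/-- The coordinates of `p` in the preferred chart at `p`. -/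
def coord (p : M) : EuclideanSpace ℝ (Fin m) := extChartAt (𝓡 m) p p

/-- The differential `df(v)` at `p`. -/
def diff {n : ℕ} (f : M → (Fin n → ℝ)) (p : M) (v : TangentSpace (𝓡 m) p) : Fin n → ℝ :=
  mfderiv (𝓡 m) 𝓘(ℝ, Fin n → ℝ) f p v

/-- The second derivative `D_w (D_v f)` at `p` in the preferred chart at `p`, with `v`, `w` extended
by constant coefficients. Paired with a vector orthogonal to the image of `df`, it gives a
coordinate-independent bilinear form. -/
def diff2 {n : ℕ} (f : M → (Fin n → ℝ)) (p : M) (v w : TangentSpace (𝓡 m) p) : Fin n → ℝ :=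
  fderiv ℝ (fun z => fderiv ℝ (inChart (m := m) f p) z v) (coord (m := m) p) w

/-- The bilinear form `⟨df, df⟩ₛ` at `p`. -/
def inducedForm (s : ℕ) {n : ℕ} (f : M → (Fin n → ℝ)) (p : M) (v w : TangentSpace (𝓡 m) p) : ℝ :=
  pinner s (diff f p v) (diff f p w)

/-- `⟨df, df⟩ₛ` is positive definite at `p`: `f` is an immersion at `p` and is space-like there. -/
def IsSpacelikeAt (m : ℕ) {M : Type*} [TopologicalSpace M]
    [ChartedSpace (EuclideanSpace ℝ (Fin m)) M] (s : ℕ) {n : ℕ} (f : M → (Fin n → ℝ)) (p : M) :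
    Prop :=
  ∀ v : TangentSpace (𝓡 m) p, v ≠ 0 → 0 < inducedForm s f p v v

/-- The Laplacian, with respect to the metric `⟨dy, dy⟩₂`, of the map `y` itself. -/
def selfLaplacian (m : ℕ) {M : Type*} [TopologicalSpace M]
    [ChartedSpace (EuclideanSpace ℝ (Fin m)) M] {n : ℕ} (y : M → (Fin n → ℝ)) (p : M) :
    Fin n → ℝ :=
  laplacian (m := m) (metricCoeff 2 (inChart y p)) (inChart y p) (coord p)

/-- The normalized scalar curvature of the metric `⟨dy, dy⟩₂`. -/
def inducedKappa (m : ℕ) {M : Type*} [TopologicalSpace M]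
    [ChartedSpace (EuclideanSpace ℝ (Fin m)) M] {n : ℕ} (y : M → (Fin n → ℝ)) (p : M) : ℝ :=
  normScalarCurvature (m := m) (metricCoeff 2 (inChart y p)) (coord p)

/-! ### The invariants attached to a map `Y` into the light cone and a normal field `ξ` -/

/-- `N = -(1/m) ΔY - (1/(2m²)) ⟨ΔY, ΔY⟩₂ Y`, with `Δ` the Laplacian of `⟨dY, dY⟩₂`. -/
def vectorN (m : ℕ) {M : Type*} [TopologicalSpace M]
    [ChartedSpace (EuclideanSpace ℝ (Fin m)) M] (Y : M → (Fin (m + 3) → ℝ)) (p : M) :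
    Fin (m + 3) → ℝ :=
  (-(1 / (m : ℝ))) • selfLaplacian m Y p -
    (1 / (2 * (m : ℝ) ^ 2) * pinner 2 (selfLaplacian m Y p) (selfLaplacian m Y p)) • Y p

/-- The conformal form `Φ = -⟨ξ, dN⟩₂`. -/
def conformalForm (Y ξ : M → (Fin (m + 3) → ℝ)) (p : M) (v : TangentSpace (𝓡 m) p) : ℝ :=
  -pinner 2 (ξ p) (diff (vectorN m Y) p v)

/-- The Blaschke tensor, with components `Aᵢⱼ = -⟨Yᵢⱼ, N⟩₂`. -/
def blaschkeTensor (Y : M → (Fin (m + 3) → ℝ)) (p : M) (v w : TangentSpace (𝓡 m) p) : ℝ :=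
  -pinner 2 (diff2 Y p v w) (vectorN m Y p)

/-- The conformal second fundamental form, with components `Bᵢⱼ = -⟨Yᵢⱼ, ξ⟩₂`. -/
def conformalSFF (Y ξ : M → (Fin (m + 3) → ℝ)) (p : M) (v w : TangentSpace (𝓡 m) p) : ℝ :=
  -pinner 2 (diff2 Y p v w) (ξ p)

/-! ### Hypersurfaces in the de Sitter space `𝕊₁ᵐ⁺¹ = {ξ ∈ ℝ₁ᵐ⁺² ; ⟨ξ, ξ⟩₁ = 1}` -/

/-- `ν` is a time-like unit normal vector at `p` of the hypersurface `x` of the de Sitter space. -/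
def IsUnitNormalAt (x : M → (Fin (m + 2) → ℝ)) (p : M) (ν : Fin (m + 2) → ℝ) : Prop :=
  pinner 1 ν ν = -1 ∧ pinner 1 ν (x p) = 0 ∧
    ∀ v : TangentSpace (𝓡 m) p, pinner 1 ν (diff x p v) = 0

/-- `n` is a smooth time-like unit normal field of `x` on the set `V`. -/
structure IsUnitNormal (x : M → (Fin (m + 2) → ℝ)) (V : Set M) (n : M → (Fin (m + 2) → ℝ)) :
    Prop where
  smooth : ContMDiffOn (𝓡 m) 𝓘(ℝ, Fin (m + 2) → ℝ) ∞ n V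
  normal : ∀ p ∈ V, IsUnitNormalAt x p (n p)

/-- The matrix `hᵢⱼ = -⟨∂ᵢ∂ⱼ x, ν⟩₁` at `p` of the scalar second fundamental form with respect to the
time-like unit normal vector `ν`; thus `hᵢⱼ ν` is the normal component of `∂ᵢ∂ⱼ x`. -/
def sffCoeff (x : M → (Fin (m + 2) → ℝ)) (p : M) (ν : Fin (m + 2) → ℝ) :
    Matrix (Fin m) (Fin m) ℝ :=
  Matrix.of fun i j => -pinner 1 (pd i (pd j (inChart x p)) (coord p)) ν

/-- The inverse matrix of the first fundamental form `⟨dx, dx⟩₁` at `p`. -/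
def invFirstFF (m : ℕ) {M : Type*} [TopologicalSpace M]
    [ChartedSpace (EuclideanSpace ℝ (Fin m)) M] (x : M → (Fin (m + 2) → ℝ)) (p : M) :
    Matrix (Fin m) (Fin m) ℝ :=
  (metricCoeff (m := m) 1 (inChart x p) (coord p))⁻¹

/-- The mean curvature `H = (1/m) tr h`. -/
def meanCurvature (x : M → (Fin (m + 2) → ℝ)) (p : M) (ν : Fin (m + 2) → ℝ) : ℝ :=
  1 / (m : ℝ) * ∑ i, ∑ j, invFirstFF m x p i j * sffCoeff x p ν i j

/-- The squared length `|h|²` of the second fundamental form. -/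
def sffNormSq (x : M → (Fin (m + 2) → ℝ)) (p : M) (ν : Fin (m + 2) → ℝ) : ℝ :=
  ∑ i, ∑ j, ∑ k, ∑ l, invFirstFF m x p i k * invFirstFF m x p j l *
    (sffCoeff x p ν i j * sffCoeff x p ν k l)

/-- `ρ² = m/(m-1) (|h|² - m H²)`. -/
def rhoSq (x : M → (Fin (m + 2) → ℝ)) (p : M) (ν : Fin (m + 2) → ℝ) : ℝ :=
  (m : ℝ) / ((m : ℝ) - 1) * (sffNormSq x p ν - (m : ℝ) * meanCurvature x p ν ^ 2)

/-- `x`, restricted to the open set `V`, is a regular space-like hypersurface of the de Sitter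
space. -/
structure IsRegularSpacelikeInDeSitter (x : M → (Fin (m + 2) → ℝ)) (V : Set M) : Prop where
  isOpen : IsOpen V
  smooth : ContMDiffOn (𝓡 m) 𝓘(ℝ, Fin (m + 2) → ℝ) ∞ x V
  mem_deSitter : ∀ p ∈ V, pinner 1 (x p) (x p) = 1
  spacelike : ∀ p ∈ V, IsSpacelikeAt m 1 x p
  regular : ∀ p ∈ V, ∀ ν, IsUnitNormalAt x p ν → 0 < rhoSq x p ν

/-- The conformal position `Y = ρ (1, x)` of `x`, with unit normal field `n`. -/
def conformalPosition (x n : M → (Fin (m + 2) → ℝ)) (p : M) : Fin (m + 3) → ℝ :=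
  Real.sqrt (rhoSq x p (n p)) • Matrix.vecCons 1 (x p)

/-- `ξ = (-H, -H x + n)`. -/
def deSitterXi (x n : M → (Fin (m + 2) → ℝ)) (p : M) : Fin (m + 3) → ℝ :=
  Matrix.vecCons (-meanCurvature x p (n p)) (-(meanCurvature x p (n p)) • x p + n p)

end Manifold

/-! ### The conformal space -/

/-- The conformal space `ℚ₁ᵐ⁺¹` of null lines in `ℝ₂ᵐ⁺³`. -/
abbrev ConformalSpace (m : ℕ) : Type :=
  {q : Projectivization ℝ (Fin (m + 3) → ℝ) // ∀ y ∈ q.submodule, pinner 2 y y = 0}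

/-- The two time-like coordinate indices of `ℝ₂ᵐ⁺³`. -/
def timeIndex (m : ℕ) (α : Fin 2) : Fin (m + 3) := Fin.castLE (by omega) α

/-- The open set `U_α` of all `[y]` whose `α`-th coordinate does not vanish. -/
def coordDomain {m : ℕ} (α : Fin 2) : Set (ConformalSpace m) :=
  {q | ∀ y ∈ q.1.submodule, y ≠ 0 → y (timeIndex m α) ≠ 0}

/-- The coordinate map `Ψ^(α)`: divide by the `α`-th time-like coordinate and delete it. It is
meaningful on `U_α` only. -/
def coordMap {m : ℕ} (α : Fin 2) (q : ConformalSpace m) : Fin (m + 2) → ℝ :=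
  Projectivization.lift
    (fun y : {y : Fin (m + 3) → ℝ // y ≠ 0} => (y.1 (timeIndex m α))⁻¹ •
      (fun i : Fin (m + 2) => y.1 ((timeIndex m α).succAbove i)))
    (by
      rintro ⟨a, ha⟩ ⟨b, hb⟩ t (rfl : a = t • b)
      have ht : t ≠ 0 := fun h => ha (by simp [h])
      ext i
      simp only [Pi.smul_apply, smul_eq_mul, mul_inv]
      field_simp)
    q.1

section ConformalHypersurface

variable {m : ℕ} {M : Type*} [TopologicalSpace M] [ChartedSpace (EuclideanSpace ℝ (Fin m)) M]

/-- `y` is a smooth lift of `xbar` on `V` to the light cone of `ℝ₂ᵐ⁺³`. -/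
structure IsLift (xbar : M → ConformalSpace m) (V : Set M) (y : M → (Fin (m + 3) → ℝ)) : Prop where
  smooth : ContMDiffOn (𝓡 m) 𝓘(ℝ, Fin (m + 3) → ℝ) ∞ y V
  lift : ∀ p ∈ V, ∃ h : y p ≠ 0, (xbar p).1 = Projectivization.mk ℝ (y p) h

/-- The conformal metric `g = -(⟨Δy, Δy⟩₂ - m² κ) ⟨dy, dy⟩₂` of a space-like hypersurface of the
conformal space, computed from a local lift `y` (on which it does not depend); `Δ` and `κ` are the
Laplacian and the normalized scalar curvature of `⟨dy, dy⟩₂`. -/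
def conformalMetric (y : M → (Fin (m + 3) → ℝ)) (p : M) (v w : TangentSpace (𝓡 m) p) : ℝ :=
  -(pinner 2 (selfLaplacian m y p) (selfLaplacian m y p) - (m : ℝ) ^ 2 * inducedKappa m y p) *
    inducedForm 2 y p v w

/-- `xbar : M → ℚ₁ᵐ⁺¹` is a regular space-like hypersurface: near every point it has a smooth lift
to the light cone (that is, `xbar` is smooth), the conformal class induced by the lift is positive
definite, and the conformal metric is non-degenerate. -/
def IsRegularSpacelike (xbar : M → ConformalSpace m) : Prop :=
  ∀ p : M, ∃ (V : Set M) (y : M → (Fin (m + 3) → ℝ)), IsOpen V ∧ p ∈ V ∧ IsLift xbar V y ∧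
    IsSpacelikeAt m 2 y p ∧
    ∀ v : TangentSpace (𝓡 m) p, v ≠ 0 → ∃ w, conformalMetric y p v w ≠ 0

/-- `Y` is a canonical lift of `xbar` on `V`: a smooth lift inducing the conformal metric. -/
structure IsCanonicalLift (xbar : M → ConformalSpace m) (V : Set M) (Y : M → (Fin (m + 3) → ℝ)) :
    Prop extends IsLift xbar V Y where
  canonical : ∀ p ∈ V, ∀ v w : TangentSpace (𝓡 m) p,
    inducedForm 2 Y p v w = conformalMetric Y p v w

/-- `ξ` is a smooth time-like unit section on `V` of the conformal normal bundle, the orthogonal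
complement in `ℝ₂ᵐ⁺³` of the span of `Y`, `N` and the image of `dY`. -/
structure IsConformalNormal (V : Set M) (Y ξ : M → (Fin (m + 3) → ℝ)) : Prop where
  smooth : ContMDiffOn (𝓡 m) 𝓘(ℝ, Fin (m + 3) → ℝ) ∞ ξ V
  unit : ∀ p ∈ V, pinner 2 (ξ p) (ξ p) = -1
  orth_Y : ∀ p ∈ V, pinner 2 (ξ p) (Y p) = 0
  orth_N : ∀ p ∈ V, pinner 2 (ξ p) (vectorN m Y p) = 0
  orth_dY : ∀ p ∈ V, ∀ v : TangentSpace (𝓡 m) p, pinner 2 (ξ p) (diff Y p v) = 0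

/-- `M^(α) = {p ; xbar p ∈ U_α}`. -/
def repDomain (xbar : M → ConformalSpace m) (α : Fin 2) : Set M := {p | xbar p ∈ coordDomain α}

/-- The de Sitter representative `x^(α) = Ψ^(α) ∘ xbar`, considered on `M^(α)` only. -/
def deSitterRep (xbar : M → ConformalSpace m) (α : Fin 2) (p : M) : Fin (m + 2) → ℝ :=
  coordMap α (xbar p)

end ConformalHypersurface

end ConformalGeometry

end

/-!
A lift of `xbar` over `M^(α)` is `y = λ P (1, x)`, where `x = x^(α)`, `λ` is the `α`-th time-like
coordinate of `y`, and the linear isometry `P` of `ℝ₂ᵐ⁺³` exchanges the first with the `α`-th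
coordinate (`IsLift.eq_timeSwap`). All invariants are built from derivatives and the inner product
and are unchanged by linear isometries, so `P` is harmless, and everything reduces to comparing the
maps `λ (1, x)` for different factors `λ`.

*The conformal metric.* The contracted Gauss equation (`sum_inv_mul_riemannCoeff`) holds for any map
`f` into a pseudo-Euclidean space that induces a non-degenerate metric, and says that the scalar
curvature is `⟨Δf, Δf⟩ - |∇²f|²`. Hence `⟨Δf, Δf⟩ - m² κ` is `m/(m-1)` times the squared length of the
trace-free part of `∇²f`. For `f = λ (1, x)` this trace-free part is orthogonal to the null vector
`(1, x)` and to the tangent vectors `(0, ∂ₖx)`, and its component along the unit normal `(0, n)` is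
`λ (h - H g)`; the orthogonal complement of `(1, x)`, the `(0, ∂ₖx)` and `(0, n)` is spanned by
`(1, x)`, so the length of the trace-free part only sees `λ (h - H g)` (`conformalFactor_coneMap`).
Therefore the conformal metric of `λ (1, x)` is `ρ² ⟨dx, dx⟩`, whatever `λ` is. Its non-degeneracy
gives `ρ² > 0`, and the conformal position is a canonical lift.

*The other invariants.* Comparing metrics, a canonical lift satisfies `λ² = ρ²`, so it is
`± P (ρ (1, x))` with a locally constant sign (`canonicalLift_eq`), that is, locally the image of the
conformal position under a linear isometry. The field `ξ = (-H, -H x + n)` is a conformal normal of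
the conformal position, the coefficient `-H` being forced by orthogonality to `N`
(`pinner_vectorN_coneMap`). Applying the isometry to it gives the direct part; reading off `n` from
a given `ξ` gives the converse.

*Smoothness.* The mean curvature and `ρ²` are computed in a chart that varies with the point. By the
Weingarten equation they are traces of expressions in first derivatives of `x` and `n`, which may be
evaluated in one fixed chart. The same remark, applied to the projection of a constant time-like
vector to the normal line, gives a global unit normal field (`exists_isUnitNormal`).
-/

noncomputable section

namespace ConformalGeometry

/-! ### The inner product and partial derivatives -/

section Pinner
variable {s n : ℕ}

lemma pinner_comm (X Y : Fin n → ℝ) : pinner s X Y = pinner s Y X := by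
  simp only [pinner, mul_comm (X _)]

/-- `pinner s` as a bilinear map. -/
def pinnerL (s n : ℕ) : (Fin n → ℝ) →ₗ[ℝ] (Fin n → ℝ) →ₗ[ℝ] ℝ :=
  LinearMap.mk₂ ℝ (pinner s)
    (fun X X' Y => by
      simp only [pinner, ← Finset.sum_add_distrib, Pi.add_apply]
      exact Finset.sum_congr rfl fun i _ => by ring)
    (fun c X Y => by
      simp only [pinner, Finset.mul_sum, Pi.smul_apply, smul_eq_mul]
      exact Finset.sum_congr rfl fun i _ => by ring)
    (fun X Y Y' => by
      simp only [pinner, ← Finset.sum_add_distrib, Pi.add_apply]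
      exact Finset.sum_congr rfl fun i _ => by ring)
    (fun c X Y => by
      simp only [pinner, Finset.mul_sum, Pi.smul_apply, smul_eq_mul]
      exact Finset.sum_congr rfl fun i _ => by ring)

@[simp] lemma pinnerL_apply (X Y : Fin n → ℝ) : pinnerL s n X Y = pinner s X Y := rfl

@[simp] lemma pinner_add_left (X X' Y : Fin n → ℝ) :
    pinner s (X + X') Y = pinner s X Y + pinner s X' Y := by
  exact LinearMap.map_add₂ (pinnerL s n) X X' Y

@[simp] lemma pinner_add_right (X Y Y' : Fin n → ℝ) :
    pinner s X (Y + Y') = pinner s X Y + pinner s X Y' := map_add (pinnerL s n X) Y Y'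

@[simp] lemma pinner_sub_left (X X' Y : Fin n → ℝ) :
    pinner s (X - X') Y = pinner s X Y - pinner s X' Y := by
  exact LinearMap.map_sub₂ (pinnerL s n) X X' Y

@[simp] lemma pinner_sub_right (X Y Y' : Fin n → ℝ) :
    pinner s X (Y - Y') = pinner s X Y - pinner s X Y' := map_sub (pinnerL s n X) Y Y'

@[simp] lemma pinner_smul_left (c : ℝ) (X Y : Fin n → ℝ) :
    pinner s (c • X) Y = c * pinner s X Y := by
  exact LinearMap.map_smul₂ (pinnerL s n) c X Y

@[simp] lemma pinner_smul_right (c : ℝ) (X Y : Fin n → ℝ) :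
    pinner s X (c • Y) = c * pinner s X Y := map_smul (pinnerL s n X) c Y

@[simp] lemma pinner_neg_left (X Y : Fin n → ℝ) : pinner s (-X) Y = -pinner s X Y := by
  exact LinearMap.map_neg₂ (pinnerL s n) X Y

@[simp] lemma pinner_neg_right (X Y : Fin n → ℝ) : pinner s X (-Y) = -pinner s X Y :=
  map_neg (pinnerL s n X) Y

@[simp] lemma pinner_zero_right (X : Fin n → ℝ) : pinner s X 0 = 0 := by simp [pinner]

lemma pinner_sum_left {ι : Type*} (t : Finset ι) (X : ι → Fin n → ℝ) (Y : Fin n → ℝ) :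
    pinner s (∑ i ∈ t, X i) Y = ∑ i ∈ t, pinner s (X i) Y := by
  exact LinearMap.map_sum₂ (pinnerL s n) t X Y

lemma pinner_sum_right {ι : Type*} (t : Finset ι) (X : Fin n → ℝ) (Y : ι → Fin n → ℝ) :
    pinner s X (∑ i ∈ t, Y i) = ∑ i ∈ t, pinner s X (Y i) := map_sum (pinnerL s n X) Y t

@[simp] lemma pinner_vecCons (a b : ℝ) (X Y : Fin n → ℝ) :
    pinner (s + 1) (Matrix.vecCons a X : Fin (n + 1) → ℝ) (Matrix.vecCons b Y) =
      -(a * b) + pinner s X Y := by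
  simp [pinner, Fin.sum_univ_succ]

lemma pinner_two_vecCons (a b : ℝ) (X Y : Fin n → ℝ) :
    pinner 2 (Matrix.vecCons a X : Fin (n + 1) → ℝ) (Matrix.vecCons b Y) =
      -(a * b) + pinner 1 X Y := pinner_vecCons (s := 1) a b X Y

/-- The form is non-degenerate: a vector orthogonal to a family with invertible Gram matrix, whose
length is the dimension, vanishes. -/
lemma eq_zero_of_gram {ι : Type*} [Fintype ι] [DecidableEq ι] (hι : Fintype.card ι = n)
    (b : ι → Fin n → ℝ) (hb : (Matrix.of fun i j => pinner s (b i) (b j)).det ≠ 0)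
    {w : Fin n → ℝ} (hw : ∀ i, pinner s w (b i) = 0) : w = 0 := by
  obtain ⟨e⟩ : Nonempty (ι ≃ Fin n) := ⟨Fintype.equivFinOfCardEq hι⟩
  have hli : LinearIndependent ℝ b := by
    rw [Fintype.linearIndependent_iff]
    intro c hc
    have h : (Matrix.of fun i j => pinner s (b i) (b j)).mulVec c = 0 := by
      ext i
      simp only [Matrix.mulVec, dotProduct, Matrix.of_apply, Pi.zero_apply]
      have := congrArg (pinner s (b i)) hc
      rw [pinner_sum_right, pinner_zero_right] at this
      simpa [mul_comm] using this
    have := Matrix.eq_zero_of_mulVec_eq_zero hb h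
    exact fun i => congrFun this i
  have hspan : ⊤ ≤ Submodule.span ℝ (Set.range b) := by
    rw [hli.span_eq_top_of_card_eq_finrank' (by simp [hι])]
  have horth : ∀ v, pinner s w v = 0 := by
    intro v
    have : Submodule.span ℝ (Set.range b) ≤ LinearMap.ker (pinnerL s n w) := by
      rw [Submodule.span_le]
      rintro _ ⟨i, rfl⟩
      exact hw i
    exact this (hspan (Submodule.mem_top (x := v)))
  ext i
  have h := horth (Pi.single i 1)
  simp only [pinner] at h
  rw [Finset.sum_eq_single i (fun j _ hj => by simp [hj]) (by simp)] at h
  split_ifs at h <;> simpa using h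

end Pinner

section Calculus

variable {m : ℕ} {F : Type*} [NormedAddCommGroup F] [NormedSpace ℝ F]
  {u : EuclideanSpace ℝ (Fin m)}

lemma pd_congr {f g : EuclideanSpace ℝ (Fin m) → F} (h : f =ᶠ[nhds u] g) (i : Fin m) :
    pd i f u = pd i g u := by
  rw [pd, pd, h.fderiv_eq]

lemma pd_congr_eventually {f g : EuclideanSpace ℝ (Fin m) → F} (h : f =ᶠ[nhds u] g) (i : Fin m) :
    pd i f =ᶠ[nhds u] pd i g := by
  filter_upwards [h.eventuallyEq_nhds] with z hz
  exact pd_congr hz i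

lemma contDiffAt_pd {k l : WithTop ℕ∞} {f : EuclideanSpace ℝ (Fin m) → F}
    (hf : ContDiffAt ℝ k f u) (hkl : l + 1 ≤ k) (i : Fin m) : ContDiffAt ℝ l (pd i f) u :=
  (hf.fderiv_right hkl).clm_apply contDiffAt_const

lemma pd_comm {f : EuclideanSpace ℝ (Fin m) → F} (hf : ContDiffAt ℝ 2 f u) (i j : Fin m) :
    pd i (pd j f) u = pd j (pd i f) u := by
  have h1 : DifferentiableAt ℝ (fderiv ℝ f) u :=
    (hf.fderiv_right (m := 1) (by norm_num)).differentiableAt (by norm_num)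
  have key : ∀ a b : Fin m, pd a (pd b f) u =
      fderiv ℝ (fderiv ℝ f) u (EuclideanSpace.single a 1) (EuclideanSpace.single b 1) := by
    intro a b
    unfold pd
    rw [fderiv_clm_apply h1 (differentiableAt_const _)]
    simp
  rw [key, key]
  exact (hf.isSymmSndFDerivAt (by simp)) _ _

lemma pd_add {f g : EuclideanSpace ℝ (Fin m) → F} (hf : DifferentiableAt ℝ f u)
    (hg : DifferentiableAt ℝ g u) (i : Fin m) :
    pd i (fun z => f z + g z) u = pd i f u + pd i g u := by
  simp [pd, fderiv_fun_add hf hg]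

lemma pd_sub {f g : EuclideanSpace ℝ (Fin m) → F} (hf : DifferentiableAt ℝ f u)
    (hg : DifferentiableAt ℝ g u) (i : Fin m) :
    pd i (fun z => f z - g z) u = pd i f u - pd i g u := by
  simp [pd, fderiv_fun_sub hf hg]

lemma pd_sum {ι : Type*} {t : Finset ι} {f : ι → EuclideanSpace ℝ (Fin m) → F}
    (hf : ∀ a ∈ t, DifferentiableAt ℝ (f a) u) (i : Fin m) :
    pd i (fun z => ∑ a ∈ t, f a z) u = ∑ a ∈ t, pd i (f a) u := by
  simp [pd, fderiv_fun_sum hf]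

lemma pd_smul {c : EuclideanSpace ℝ (Fin m) → ℝ} {f : EuclideanSpace ℝ (Fin m) → F}
    (hc : DifferentiableAt ℝ c u) (hf : DifferentiableAt ℝ f u) (i : Fin m) :
    pd i (fun z => c z • f z) u = c u • pd i f u + pd i c u • f u := by
  simp [pd, fderiv_fun_smul hc hf]

@[simp] lemma pd_const (c : F) (i : Fin m) : pd i (fun _ => c) u = 0 := by
  simp [pd]

lemma pd_clm {F' : Type*} [NormedAddCommGroup F'] [NormedSpace ℝ F'] (L : F →L[ℝ] F')
    {f : EuclideanSpace ℝ (Fin m) → F} (hf : DifferentiableAt ℝ f u) (i : Fin m) :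
    pd i (fun z => L (f z)) u = L (pd i f u) := by
  have : fderiv ℝ (fun z => L (f z)) u = L.comp (fderiv ℝ f u) :=
    (L.hasFDerivAt.comp u hf.hasFDerivAt).fderiv
  simp [pd, this]

variable {n s : ℕ}

/-- `pinner s` as a continuous bilinear map. -/
def pinnerCLM (s n : ℕ) : (Fin n → ℝ) →L[ℝ] (Fin n → ℝ) →L[ℝ] ℝ :=
  LinearMap.toContinuousLinearMap (LinearMap.toContinuousLinearMap.toLinearMap ∘ₗ pinnerL s n)

@[simp] lemma pinnerCLM_apply (X Y : Fin n → ℝ) : pinnerCLM s n X Y = pinner s X Y := rfl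

lemma contDiffAt_pinner {k : WithTop ℕ∞} {f g : EuclideanSpace ℝ (Fin m) → Fin n → ℝ}
    (hf : ContDiffAt ℝ k f u) (hg : ContDiffAt ℝ k g u) :
    ContDiffAt ℝ k (fun z => pinner s (f z) (g z)) u :=
  (((pinnerCLM s n).contDiff.contDiffAt).comp u hf).clm_apply hg

lemma pd_pinner {f g : EuclideanSpace ℝ (Fin m) → Fin n → ℝ} (hf : DifferentiableAt ℝ f u)
    (hg : DifferentiableAt ℝ g u) (i : Fin m) :
    pd i (fun z => pinner s (f z) (g z)) u =
      pinner s (pd i f u) (g u) + pinner s (f u) (pd i g u) := by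
  have h := (((pinnerCLM s n).hasFDerivAt.comp u hf.hasFDerivAt).clm_apply hg.hasFDerivAt).fderiv
  have h' : fderiv ℝ (fun z => pinner s (f z) (g z)) u = _ := h
  rw [pd, h']
  simp [pd, add_comm]

end Calculus

/-! ### The Gauss equation in coordinates -/

section Gauss

variable {m : ℕ} {u : EuclideanSpace ℝ (Fin m)}

lemma contDiffAt_det {k : WithTop ℕ∞} {G : EuclideanSpace ℝ (Fin m) → Matrix (Fin m) (Fin m) ℝ}
    (hG : ∀ i j, ContDiffAt ℝ k (fun z => G z i j) u) : ContDiffAt ℝ k (fun z => (G z).det) u := by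
  simp only [Matrix.det_apply']
  exact ContDiffAt.sum fun σ _ => contDiffAt_const.mul (contDiffAt_prod fun i _ => hG _ _)

lemma contDiffAt_inv_entry {k : WithTop ℕ∞}
    {G : EuclideanSpace ℝ (Fin m) → Matrix (Fin m) (Fin m) ℝ}
    (hG : ∀ i j, ContDiffAt ℝ k (fun z => G z i j) u) (hdet : (G u).det ≠ 0) (i j : Fin m) :
    ContDiffAt ℝ k (fun z => (G z)⁻¹ i j) u := by
  simp only [Matrix.inv_def, Matrix.smul_apply, Ring.inverse_eq_inv', Matrix.adjugate_apply,
    smul_eq_mul]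
  refine ((contDiffAt_det hG).inv hdet).mul (contDiffAt_det fun a b => ?_)
  simp only [Matrix.updateRow_apply]
  split_ifs
  · exact contDiffAt_const
  · exact hG a b

lemma sum_sum_inv_mul {G : Matrix (Fin m) (Fin m) ℝ} (hG : G.IsSymm) (hdet : G.det ≠ 0)
    (a : Fin m → ℝ) (j : Fin m) : ∑ k, (∑ l, G⁻¹ k l * a l) * G k j = a j := by
  have h : G.mulVec (G⁻¹.mulVec a) = a := by
    rw [Matrix.mulVec_mulVec, Matrix.mul_nonsing_inv _ (isUnit_iff_ne_zero.mpr hdet),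
      Matrix.one_mulVec]
  rw [← congrFun h j]
  simp only [Matrix.mulVec, dotProduct]
  exact Finset.sum_congr rfl fun k _ => by rw [hG.apply j k, mul_comm]

lemma sum_sum_mul_inv {G : Matrix (Fin m) (Fin m) ℝ} (hdet : G.det ≠ 0)
    (a : Fin m → ℝ) (j : Fin m) : ∑ k, (∑ l, a l * G l k) * G⁻¹ k j = a j := by
  have h : Matrix.vecMul (Matrix.vecMul a G) G⁻¹ = a := by
    rw [Matrix.vecMul_vecMul, Matrix.mul_nonsing_inv _ (isUnit_iff_ne_zero.mpr hdet),
      Matrix.vecMul_one]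
  exact congrFun h j

variable {s n : ℕ} {f : EuclideanSpace ℝ (Fin m) → Fin n → ℝ}

lemma metricCoeff_isSymm (s : ℕ) (f : EuclideanSpace ℝ (Fin m) → Fin n → ℝ)
    (u : EuclideanSpace ℝ (Fin m)) : (metricCoeff s f u).IsSymm := by
  ext i j
  simp [metricCoeff, pinner_comm]

/-- The covariant second derivative `∂ᵢ∂ⱼf - Γᵏᵢⱼ ∂ₖf` of a map `f` with respect to the metric
that it induces. -/
def covHess (s : ℕ) (f : EuclideanSpace ℝ (Fin m) → Fin n → ℝ) (i j : Fin m)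
    (u : EuclideanSpace ℝ (Fin m)) : Fin n → ℝ :=
  pd i (pd j f) u - ∑ k, christoffel (metricCoeff s f) k i j u • pd k f u

lemma laplacian_eq_sum_covHess :
    laplacian (metricCoeff s f) f u =
      ∑ i, ∑ j, (metricCoeff s f u)⁻¹ i j • covHess s f i j u := rfl

lemma christoffel_eq (hf : ContDiffAt ℝ 2 f u) (k i j : Fin m) :
    christoffel (metricCoeff s f) k i j u =
      ∑ l, (metricCoeff s f u)⁻¹ k l * pinner s (pd i (pd j f) u) (pd l f u) := by
  have hd : ∀ a, DifferentiableAt ℝ (pd a f) u := fun a =>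
    (contDiffAt_pd (l := 1) hf (by norm_num) a).differentiableAt (by norm_num)
  unfold christoffel
  rw [Finset.mul_sum]
  refine Finset.sum_congr rfl fun l _ => ?_
  simp only [metricCoeff, Matrix.of_apply]
  rw [pd_pinner (hd j) (hd l), pd_pinner (hd i) (hd l), pd_pinner (hd i) (hd j),
    pd_comm hf j i, pd_comm hf l i, pd_comm hf l j, pinner_comm (pd j f u) (pd i (pd l f) u)]
  ring

lemma covHess_comm (hf : ContDiffAt ℝ 2 f u) (i j : Fin m) :
    covHess s f i j u = covHess s f j i u := by
  unfold covHess
  rw [pd_comm hf i j]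
  simp only [christoffel_eq hf, pd_comm hf i j]

lemma pinner_pd_pd (hf : ContDiffAt ℝ 2 f u) (hdet : (metricCoeff s f u).det ≠ 0) (i j l : Fin m) :
    pinner s (pd i (pd j f) u) (pd l f u) =
      ∑ k, christoffel (metricCoeff s f) k i j u * metricCoeff s f u k l := by
  simp only [christoffel_eq hf]
  rw [sum_sum_inv_mul (metricCoeff_isSymm s f u) hdet
    (fun l => pinner s (pd i (pd j f) u) (pd l f u))]

lemma pinner_covHess_pd (hf : ContDiffAt ℝ 2 f u) (hdet : (metricCoeff s f u).det ≠ 0)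
    (i j l : Fin m) : pinner s (covHess s f i j u) (pd l f u) = 0 := by
  rw [covHess, pinner_sub_left, pinner_sum_left, pinner_pd_pd hf hdet]
  simp [metricCoeff]

lemma pinner_covHess_covHess (hf : ContDiffAt ℝ 2 f u) (hdet : (metricCoeff s f u).det ≠ 0)
    (i j k l : Fin m) : pinner s (covHess s f i j u) (pd k (pd l f) u) =
      pinner s (covHess s f i j u) (covHess s f k l u) := by
  conv_rhs => rw [covHess.eq_def s f k l u]
  rw [pinner_sub_right, pinner_sum_right]
  simp [pinner_covHess_pd hf hdet]

lemma contDiffAt_metricCoeff {k l : WithTop ℕ∞} (hf : ContDiffAt ℝ k f u) (hkl : l + 1 ≤ k)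
    (i j : Fin m) : ContDiffAt ℝ l (fun z => metricCoeff s f z i j) u :=
  contDiffAt_pinner (contDiffAt_pd hf hkl i) (contDiffAt_pd hf hkl j)

lemma contDiffAt_christoffel (hf : ContDiffAt ℝ 3 f u) (hdet : (metricCoeff s f u).det ≠ 0)
    (k i j : Fin m) : ContDiffAt ℝ 1 (christoffel (metricCoeff s f) k i j) u := by
  have h2 : ∀ a b, ContDiffAt ℝ 2 (fun z => metricCoeff s f z a b) u := fun a b =>
    contDiffAt_metricCoeff hf (by norm_num) a b
  have h1 : ∀ a b c, ContDiffAt ℝ 1 (pd c (fun z => metricCoeff s f z a b)) u := fun a b c =>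
    contDiffAt_pd (h2 a b) (by norm_num) c
  have hi : ∀ a b, ContDiffAt ℝ 1 (fun z => (metricCoeff s f z)⁻¹ a b) u := fun a b =>
    (contDiffAt_inv_entry h2 hdet a b).of_le (by norm_num)
  unfold christoffel
  exact contDiffAt_const.mul (ContDiffAt.sum fun l _ =>
    (hi k l).mul (((h1 _ _ _).add (h1 _ _ _)).sub (h1 _ _ _)))

lemma eventually_det_ne_zero (hf : ContDiffAt ℝ 1 f u) (hdet : (metricCoeff s f u).det ≠ 0) :
    ∀ᶠ z in nhds u, (metricCoeff s f z).det ≠ 0 :=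
  (contDiffAt_det fun i j =>
    contDiffAt_metricCoeff (l := 0) hf (by norm_num) i j).continuousAt.eventually_ne hdet

/-- The tangential part of the third derivative of `f`; skew-symmetrizing it in `i`, `j` gives the
Gauss equation. -/
lemma pinner_pd_pd_pd (hf : ContDiffAt ℝ 3 f u) (hdet : (metricCoeff s f u).det ≠ 0)
    (i j k p : Fin m) :
    pinner s (pd i (pd j (pd k f)) u) (pd p f u) =
      ∑ l, (pd i (christoffel (metricCoeff s f) l j k) u +
          ∑ a, christoffel (metricCoeff s f) l i a u * christoffel (metricCoeff s f) a j k u) *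
        metricCoeff s f u l p -
      pinner s (covHess s f j k u) (covHess s f i p u) := by
  have hf2 : ContDiffAt ℝ 2 f u := hf.of_le (by norm_num)
  have hpd : ∀ a, ContDiffAt ℝ 2 (pd a f) u := fun a => contDiffAt_pd hf (by norm_num) a
  have hd : ∀ a, DifferentiableAt ℝ (pd a f) u := fun a => (hpd a).differentiableAt (by norm_num)
  have hd2 : ∀ a b, DifferentiableAt ℝ (pd a (pd b f)) u := fun a b =>
    (contDiffAt_pd (l := 1) (hpd b) (by norm_num) a).differentiableAt (by norm_num)
  have hΓ : ∀ a b c, DifferentiableAt ℝ (christoffel (metricCoeff s f) a b c) u := fun a b c =>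
    (contDiffAt_christoffel hf hdet a b c).differentiableAt (by norm_num)
  have hs : ∀ l, DifferentiableAt ℝ
      (fun z => christoffel (metricCoeff s f) l j k z • pd l f z) u := fun l =>
    (hΓ l j k).smul (hd l)
  have hsum : DifferentiableAt ℝ
      (fun z => ∑ l, christoffel (metricCoeff s f) l j k z • pd l f z) u :=
    DifferentiableAt.fun_sum fun l _ => hs l
  have hT : DifferentiableAt ℝ (covHess s f j k) u := (hd2 j k).sub hsum
  have hpdT : pd i (covHess s f j k) u = pd i (pd j (pd k f)) u -
      ∑ l, (christoffel (metricCoeff s f) l j k u • pd i (pd l f) u +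
        pd i (christoffel (metricCoeff s f) l j k) u • pd l f u) := by
    have h1 : pd i (covHess s f j k) u = _ := pd_sub (hd2 j k) hsum i
    rw [h1, pd_sum (fun l _ => hs l)]
    simp only [pd_smul (hΓ _ j k) (hd _)]
  have hzero : (fun z => pinner s (covHess s f j k z) (pd p f z)) =ᶠ[nhds u] fun _ => 0 := by
    filter_upwards [eventually_det_ne_zero (hf.of_le (by norm_num)) hdet,
      hf2.eventually (by simp)] with z hz hfz
    exact pinner_covHess_pd hfz hz j k p
  have hder := pd_congr hzero i
  rw [pd_pinner hT (hd p), pd_const, hpdT, pinner_covHess_covHess hf2 hdet, pinner_sub_left,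
    pinner_sum_left] at hder
  simp only [pinner_add_left, pinner_smul_left, pinner_pd_pd hf2 hdet] at hder
  have hrw : ∑ l, (pd i (christoffel (metricCoeff s f) l j k) u +
          ∑ a, christoffel (metricCoeff s f) l i a u * christoffel (metricCoeff s f) a j k u) *
        metricCoeff s f u l p =
      ∑ l, (christoffel (metricCoeff s f) l j k u *
          ∑ a, christoffel (metricCoeff s f) a i l u * metricCoeff s f u a p +
        pd i (christoffel (metricCoeff s f) l j k) u * pinner s (pd l f u) (pd p f u)) := by
    simp only [add_mul, Finset.sum_add_distrib, Finset.sum_mul, Finset.mul_sum]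
    rw [add_comm, Finset.sum_comm]
    congr 1
    exact Finset.sum_congr rfl fun l _ => Finset.sum_congr rfl fun a _ => by ring
  rw [hrw]
  linarith

/-- The **Gauss equation**. -/
lemma sum_riemannCoeff_mul (hf : ContDiffAt ℝ 3 f u) (hdet : (metricCoeff s f u).det ≠ 0)
    (k i j p : Fin m) :
    ∑ l, riemannCoeff (metricCoeff s f) l k i j u * metricCoeff s f u l p =
      pinner s (covHess s f j k u) (covHess s f i p u) -
        pinner s (covHess s f i k u) (covHess s f j p u) := by
  have h1 := pinner_pd_pd_pd (s := s) hf hdet i j k p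
  have h2 := pinner_pd_pd_pd (s := s) hf hdet j i k p
  rw [pd_comm (contDiffAt_pd hf (by norm_num) k) j i, h1] at h2
  have h3 : ∑ l, riemannCoeff (metricCoeff s f) l k i j u * metricCoeff s f u l p =
      ∑ l, (pd i (christoffel (metricCoeff s f) l j k) u +
          ∑ a, christoffel (metricCoeff s f) l i a u * christoffel (metricCoeff s f) a j k u) *
        metricCoeff s f u l p -
      ∑ l, (pd j (christoffel (metricCoeff s f) l i k) u +
          ∑ a, christoffel (metricCoeff s f) l j a u * christoffel (metricCoeff s f) a i k u) *
        metricCoeff s f u l p := by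
    rw [← Finset.sum_sub_distrib]
    refine Finset.sum_congr rfl fun l _ => ?_
    rw [riemannCoeff, Finset.sum_sub_distrib]
    ring
  rw [h3]
  linarith

/-- The contracted Gauss equation: the scalar curvature of the metric induced by `f` is
`⟨Δf, Δf⟩ - |∇²f|²`. -/
lemma sum_inv_mul_riemannCoeff (hf : ContDiffAt ℝ 3 f u) (hdet : (metricCoeff s f u).det ≠ 0) :
    ∑ j, ∑ k, (metricCoeff s f u)⁻¹ j k * ∑ i, riemannCoeff (metricCoeff s f) i k i j u =
      pinner s (laplacian (metricCoeff s f) f u) (laplacian (metricCoeff s f) f u) -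
      ∑ i, ∑ j, ∑ k, ∑ l, (metricCoeff s f u)⁻¹ i k * (metricCoeff s f u)⁻¹ j l *
        pinner s (covHess s f i j u) (covHess s f k l u) := by
  have hf2 : ContDiffAt ℝ 2 f u := hf.of_le (by norm_num)
  have hR : ∀ i j k, riemannCoeff (metricCoeff s f) i k i j u = ∑ p,
      (pinner s (covHess s f j k u) (covHess s f i p u) -
        pinner s (covHess s f i k u) (covHess s f j p u)) * (metricCoeff s f u)⁻¹ p i := by
    intro i j k
    rw [← sum_sum_mul_inv hdet (fun l => riemannCoeff (metricCoeff s f) l k i j u) i]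
    simp only [sum_riemannCoeff_mul hf hdet]
  have hsymm : ∀ a b, (metricCoeff s f u)⁻¹ a b = (metricCoeff s f u)⁻¹ b a := fun a b =>
    ((metricCoeff_isSymm s f u).inv).apply b a
  simp only [laplacian_eq_sum_covHess, pinner_sum_left, pinner_sum_right, pinner_smul_left,
    pinner_smul_right, hR, sub_mul, Finset.sum_sub_distrib, mul_sub, Finset.mul_sum]
  congr 1
  · refine Finset.sum_congr rfl fun j _ => Finset.sum_congr rfl fun k _ =>
      Finset.sum_congr rfl fun i _ => Finset.sum_congr rfl fun p _ => ?_
    rw [hsymm p i, pinner_comm (covHess s f i p u)]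
    ring
  · refine Finset.sum_congr rfl fun j _ => ?_
    have : ∀ k, ∑ i, ∑ p, (metricCoeff s f u)⁻¹ j k *
        (pinner s (covHess s f i k u) (covHess s f j p u) * (metricCoeff s f u)⁻¹ p i) =
        ∑ p, ∑ i, (metricCoeff s f u)⁻¹ j k * (metricCoeff s f u)⁻¹ p i *
          pinner s (covHess s f j p u) (covHess s f k i u) := by
      intro k
      rw [Finset.sum_comm]
      refine Finset.sum_congr rfl fun p _ => Finset.sum_congr rfl fun i _ => ?_
      rw [covHess_comm hf2 i k, pinner_comm (covHess s f k i u)]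
      ring
    simp only [this]
    exact Finset.sum_comm

end Gauss

/-! ### Traces and trace-free parts -/

section Trace

variable {m : ℕ} {V : Type*} [AddCommGroup V] [Module ℝ V] {G : Matrix (Fin m) (Fin m) ℝ}

/-- The squared length `Gⁱᵏ Gʲˡ b(Tᵢⱼ, Tₖₗ)` of a vector-valued covariant 2-tensor, `Gi` being the
inverse of the metric and `b` the bilinear form on the values. -/
def normSq (b : V →ₗ[ℝ] V →ₗ[ℝ] ℝ) (Gi : Matrix (Fin m) (Fin m) ℝ) (T : Fin m → Fin m → V) : ℝ :=
  ∑ i, ∑ j, ∑ k, ∑ l, Gi i k * Gi j l * b (T i j) (T k l)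

/-- The trace `Gⁱʲ Tᵢⱼ`. -/
def trace₂ (Gi : Matrix (Fin m) (Fin m) ℝ) (T : Fin m → Fin m → V) : V :=
  ∑ i, ∑ j, Gi i j • T i j

lemma sum_inv_mul_inv_mul (hG : G.IsSymm) (hdet : G.det ≠ 0) (i j : Fin m) :
    ∑ k, ∑ l, G⁻¹ i k * G⁻¹ j l * G k l = G⁻¹ i j := by
  have h : G⁻¹ * G * G⁻¹ = G⁻¹ := by
    rw [Matrix.nonsing_inv_mul _ (isUnit_iff_ne_zero.mpr hdet), Matrix.one_mul]
  have h2 := congrFun (congrFun h i) j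
  rw [Matrix.mul_apply] at h2
  rw [← h2, Finset.sum_comm]
  refine Finset.sum_congr rfl fun l _ => ?_
  rw [Matrix.mul_apply, Finset.sum_mul]
  refine Finset.sum_congr rfl fun k _ => ?_
  rw [hG.inv.apply l j]
  ring

lemma sum_inv_mul_self (hG : G.IsSymm) (hdet : G.det ≠ 0) :
    ∑ i, ∑ j, G⁻¹ i j * G i j = m := by
  have h : (G⁻¹ * G).trace = m := by
    rw [Matrix.nonsing_inv_mul _ (isUnit_iff_ne_zero.mpr hdet), Matrix.trace_one, Fintype.card_fin]
  rw [← h, Matrix.trace]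
  refine Finset.sum_congr rfl fun i _ => ?_
  rw [Matrix.diag_apply, Matrix.mul_apply]
  exact Finset.sum_congr rfl fun j _ => by rw [hG.apply i j]

lemma sum_rotate {ι κ W : Type*} [Fintype ι] [Fintype κ] [AddCommMonoid W] (a : ι → κ → κ → W) :
    ∑ i, ∑ k, ∑ l, a i k l = ∑ k, ∑ l, ∑ i, a i k l := by
  rw [Finset.sum_comm]
  exact Finset.sum_congr rfl fun k _ => Finset.sum_comm

/-- Removing the trace of `T`, whose value is `D`, decreases the squared length by `b(D, D) / m`. -/
lemma normSq_sub_trace (hm : m ≠ 0) (hG : G.IsSymm) (hdet : G.det ≠ 0) (b : V →ₗ[ℝ] V →ₗ[ℝ] ℝ)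
    (T : Fin m → Fin m → V) :
    normSq b G⁻¹ (fun i j => T i j - (1 / (m : ℝ) * G i j) • trace₂ G⁻¹ T) =
      normSq b G⁻¹ T - 1 / (m : ℝ) * b (trace₂ G⁻¹ T) (trace₂ G⁻¹ T) := by
  have hm' : (m : ℝ) ≠ 0 := Nat.cast_ne_zero.mpr hm
  set D := trace₂ G⁻¹ T with hD
  have hφ : ∀ φ : V →ₗ[ℝ] ℝ, φ D = ∑ i, ∑ j, G⁻¹ i j * φ (T i j) := by
    intro φ
    simp only [hD, trace₂, map_sum, map_smul, smul_eq_mul]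
  have h1 : ∑ i, ∑ j, ∑ k, ∑ l, G⁻¹ i k * G⁻¹ j l * (G k l * b (T i j) D) = b D D := by
    have : ∀ i j, ∑ k, ∑ l, G⁻¹ i k * G⁻¹ j l * (G k l * b (T i j) D) =
        G⁻¹ i j * b (T i j) D := by
      intro i j
      rw [← sum_inv_mul_inv_mul hG hdet i j]
      simp only [Finset.sum_mul, mul_assoc]
    simp only [this]
    exact (hφ (b.flip D)).symm
  have h2 : ∑ i, ∑ j, ∑ k, ∑ l, G⁻¹ i k * G⁻¹ j l * (G i j * b D (T k l)) = b D D := by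
    rw [(Finset.sum_congr rfl fun i _ => sum_rotate _).trans (sum_rotate _)]
    have : ∀ k l, ∑ i, ∑ j, G⁻¹ i k * G⁻¹ j l * (G i j * b D (T k l)) =
        G⁻¹ k l * b D (T k l) := by
      intro k l
      rw [← sum_inv_mul_inv_mul hG hdet k l]
      simp only [Finset.sum_mul, hG.inv.apply, ← mul_assoc]
    simp only [this]
    exact (hφ (b D)).symm
  have h3 : ∑ i, ∑ j, ∑ k, ∑ l, G⁻¹ i k * G⁻¹ j l * (G i j * G k l) = (m : ℝ) := by
    rw [← sum_inv_mul_self hG hdet]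
    refine Finset.sum_congr rfl fun i _ => Finset.sum_congr rfl fun j _ => ?_
    conv_rhs => rw [← sum_inv_mul_inv_mul hG hdet i j]
    simp only [Finset.sum_mul]
    exact Finset.sum_congr rfl fun i _ => Finset.sum_congr rfl fun j _ => by ring
  have hexp : ∀ i j k l, G⁻¹ i k * G⁻¹ j l *
      b (T i j - (1 / (m : ℝ) * G i j) • D) (T k l - (1 / (m : ℝ) * G k l) • D) =
      G⁻¹ i k * G⁻¹ j l * b (T i j) (T k l)
        - 1 / (m : ℝ) * (G⁻¹ i k * G⁻¹ j l * (G k l * b (T i j) D))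
        - 1 / (m : ℝ) * (G⁻¹ i k * G⁻¹ j l * (G i j * b D (T k l)))
        + 1 / (m : ℝ) * (1 / (m : ℝ)) * b D D * (G⁻¹ i k * G⁻¹ j l * (G i j * G k l)) := by
    intro i j k l
    simp only [map_sub, map_smul, LinearMap.sub_apply, LinearMap.smul_apply, smul_eq_mul]
    ring
  unfold normSq
  simp only [hexp, Finset.sum_add_distrib, Finset.sum_sub_distrib, ← Finset.mul_sum, h1, h2, h3]
  field_simp
  ring

open scoped MatrixOrder Matrix.Norms.L2Operator in
/-- With `Gi = Bᵀ B` the squared length of a real-valued tensor is a sum of squares. -/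
lemma normSq_mul_nonneg {Gi : Matrix (Fin m) (Fin m) ℝ} (hGi : Gi.PosSemidef)
    (h : Fin m → Fin m → ℝ) : 0 ≤ normSq (LinearMap.mul ℝ ℝ) Gi h := by
  obtain ⟨B, rfl⟩ := CStarAlgebra.nonneg_iff_eq_star_mul_self.mp hGi.nonneg
  have : normSq (LinearMap.mul ℝ ℝ) (star B * B) h =
      ∑ a, ∑ c, (∑ i, ∑ j, B a i * B c j * h i j) ^ 2 := by
    have hsq : ∀ a c, (∑ i, ∑ j, B a i * B c j * h i j) ^ 2 =
        ∑ i, ∑ j, ∑ k, ∑ l, B a i * B a k * (B c j * B c l) * (h i j * h k l) := by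
      intro a c
      simp only [sq, Finset.sum_mul, Finset.mul_sum]
      exact Finset.sum_congr rfl fun i _ => Finset.sum_congr rfl fun j _ =>
        Finset.sum_congr rfl fun k _ => Finset.sum_congr rfl fun l _ => by ring
    have hterm : ∀ i j k l, (star B * B) i k * (star B * B) j l *
        (h i j * h k l) = ∑ a, ∑ c, B a i * B a k * (B c j * B c l) * (h i j * h k l) := by
      intro i j k l
      simp only [Matrix.mul_apply, Matrix.star_apply, star_trivial, Finset.mul_sum,
        Finset.sum_mul]
      exact Finset.sum_comm
    simp only [normSq, LinearMap.mul_apply', hterm, hsq]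
    exact (Finset.sum_congr rfl fun i _ => (Finset.sum_congr rfl fun j _ =>
      (Finset.sum_congr rfl fun k _ => sum_rotate _).trans (sum_rotate _)).trans
        (sum_rotate _)).trans (sum_rotate _)
  rw [this]
  positivity

end Trace

/-! ### The light cone map `λ (1, x)` in coordinates -/

section LightCone

variable {m : ℕ} {u : EuclideanSpace ℝ (Fin m)}

lemma pd_apply {n : ℕ} {f : EuclideanSpace ℝ (Fin m) → Fin n → ℝ} (hf : DifferentiableAt ℝ f u)
    (i : Fin m) (j : Fin n) : pd i f u j = pd i (fun z => f z j) u :=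
  (pd_clm (ContinuousLinearMap.proj (R := ℝ) (φ := fun _ : Fin n => ℝ) j) hf i).symm

lemma contDiffAt_vecCons {E : Type*} [NormedAddCommGroup E] [NormedSpace ℝ E] {v : E} {n : ℕ}
    {k : WithTop ℕ∞} {a : E → ℝ} {f : E → Fin n → ℝ} (ha : ContDiffAt ℝ k a v)
    (hf : ContDiffAt ℝ k f v) :
    ContDiffAt ℝ k (fun z => (Matrix.vecCons (a z) (f z) : Fin (n + 1) → ℝ)) v := by
  rw [contDiffAt_pi]
  refine Fin.cases ha fun j => ?_
  exact contDiffAt_pi.mp hf j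

lemma differentiableAt_vecCons {E : Type*} [NormedAddCommGroup E] [NormedSpace ℝ E] {v : E} {n : ℕ}
    {a : E → ℝ} {f : E → Fin n → ℝ} (ha : DifferentiableAt ℝ a v) (hf : DifferentiableAt ℝ f v) :
    DifferentiableAt ℝ (fun z => (Matrix.vecCons (a z) (f z) : Fin (n + 1) → ℝ)) v := by
  rw [differentiableAt_pi]
  refine Fin.cases ha fun j => ?_
  exact differentiableAt_pi.mp hf j

lemma pd_vecCons {n : ℕ} {a : EuclideanSpace ℝ (Fin m) → ℝ}
    {f : EuclideanSpace ℝ (Fin m) → Fin n → ℝ} (ha : DifferentiableAt ℝ a u)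
    (hf : DifferentiableAt ℝ f u) (i : Fin m) :
    pd i (fun z => (Matrix.vecCons (a z) (f z) : Fin (n + 1) → ℝ)) u =
      Matrix.vecCons (pd i a u) (pd i f u) := by
  ext j
  rw [pd_apply (differentiableAt_vecCons ha hf)]
  refine Fin.cases ?_ (fun j => ?_) j
  · simp
  · simp [pd_apply hf]

variable {x : EuclideanSpace ℝ (Fin m) → Fin (m + 2) → ℝ} {l : EuclideanSpace ℝ (Fin m) → ℝ}
  {ν : Fin (m + 2) → ℝ}

/-- The map `λ (1, x)` into the light cone. -/
def coneMap {E : Type*} {n : ℕ} (l : E → ℝ) (x : E → Fin n → ℝ) (z : E) : Fin (n + 1) → ℝ :=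
  l z • Matrix.vecCons 1 (x z)

/-- The scalar second fundamental form of a map `x` into the de Sitter space, in coordinates. -/
def sff (x : EuclideanSpace ℝ (Fin m) → Fin (m + 2) → ℝ) (ν : Fin (m + 2) → ℝ)
    (u : EuclideanSpace ℝ (Fin m)) : Matrix (Fin m) (Fin m) ℝ :=
  Matrix.of fun i j => -pinner 1 (pd i (pd j x) u) ν

lemma pinner_pd_self (hx : DifferentiableAt ℝ x u)
    (hone : ∀ᶠ z in nhds u, pinner 1 (x z) (x z) = 1) (i : Fin m) :
    pinner 1 (x u) (pd i x u) = 0 := by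
  have h := pd_congr (f := fun z => pinner 1 (x z) (x z)) (g := fun _ => (1 : ℝ)) hone i
  rw [pd_pinner hx hx, pd_const, pinner_comm] at h
  linarith

lemma pinner_pd_pd_self (hx : ContDiffAt ℝ 2 x u)
    (hone : ∀ᶠ z in nhds u, pinner 1 (x z) (x z) = 1) (i j : Fin m) :
    pinner 1 (x u) (pd i (pd j x) u) = -metricCoeff 1 x u i j := by
  have hev : (fun z => pinner 1 (x z) (pd j x z)) =ᶠ[nhds u] fun _ => 0 := by
    filter_upwards [hone.eventually_nhds, hx.eventually (by simp)] with z hz hxz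
    exact pinner_pd_self (hxz.differentiableAt (by norm_num)) hz j
  have h := pd_congr hev i
  rw [pd_pinner (hx.differentiableAt (by norm_num))
    ((contDiffAt_pd (l := 1) hx (by norm_num) j).differentiableAt (by norm_num)), pd_const] at h
  simp only [metricCoeff, Matrix.of_apply]
  linarith

lemma contDiffAt_coneMap {k : WithTop ℕ∞} (hx : ContDiffAt ℝ k x u) (hl : ContDiffAt ℝ k l u) :
    ContDiffAt ℝ k (coneMap l x) u :=
  hl.smul (contDiffAt_vecCons contDiffAt_const hx)

lemma pd_coneMap (hx : DifferentiableAt ℝ x u) (hl : DifferentiableAt ℝ l u) (i : Fin m) :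
    pd i (coneMap l x) u =
      l u • Matrix.vecCons 0 (pd i x u) + pd i l u • Matrix.vecCons 1 (x u) := by
  have h := pd_smul hl (differentiableAt_vecCons (differentiableAt_const (1 : ℝ)) hx) i
  rw [pd_vecCons (differentiableAt_const _) hx, pd_const] at h
  exact h

lemma pd_pd_coneMap (hx : ContDiffAt ℝ 2 x u) (hl : ContDiffAt ℝ 2 l u) (i j : Fin m) :
    pd i (pd j (coneMap l x)) u =
      l u • Matrix.vecCons 0 (pd i (pd j x) u) + pd i l u • Matrix.vecCons 0 (pd j x u) +
      (pd j l u • Matrix.vecCons 0 (pd i x u) + pd i (pd j l) u • Matrix.vecCons 1 (x u)) := by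
  have hev : pd j (coneMap l x) =ᶠ[nhds u] fun z =>
      l z • Matrix.vecCons 0 (pd j x z) + pd j l z • Matrix.vecCons 1 (x z) := by
    filter_upwards [hx.eventually (by simp), hl.eventually (by simp)] with z hxz hlz
    exact pd_coneMap (hxz.differentiableAt (by norm_num)) (hlz.differentiableAt (by norm_num)) j
  have hxd := hx.differentiableAt (by norm_num)
  have hld := hl.differentiableAt (by norm_num)
  have hxj : DifferentiableAt ℝ (pd j x) u :=
    (contDiffAt_pd (l := 1) hx (by norm_num) j).differentiableAt (by norm_num)
  have hlj : DifferentiableAt ℝ (pd j l) u :=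
    (contDiffAt_pd (l := 1) hl (by norm_num) j).differentiableAt (by norm_num)
  have h0 : DifferentiableAt ℝ (fun z => (Matrix.vecCons 0 (pd j x z) : Fin (m + 2 + 1) → ℝ)) u :=
    differentiableAt_vecCons (differentiableAt_const _) hxj
  have h1 : DifferentiableAt ℝ (fun z => (Matrix.vecCons 1 (x z) : Fin (m + 2 + 1) → ℝ)) u :=
    differentiableAt_vecCons (differentiableAt_const _) hxd
  rw [pd_congr hev, pd_add (hld.fun_smul h0) (hlj.fun_smul h1), pd_smul hld h0, pd_smul hlj h1,
    pd_vecCons (differentiableAt_const _) hxj, pd_vecCons (differentiableAt_const _) hxd,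
    pd_const, pd_const]

lemma metricCoeff_coneMap (hx : DifferentiableAt ℝ x u) (hl : DifferentiableAt ℝ l u)
    (hone : ∀ᶠ z in nhds u, pinner 1 (x z) (x z) = 1) :
    metricCoeff 2 (coneMap l x) u = (l u ^ 2) • metricCoeff 1 x u := by
  ext i j
  have h1 := hone.self_of_nhds
  simp only [metricCoeff, Matrix.of_apply, Matrix.smul_apply, smul_eq_mul, pd_coneMap hx hl,
    pinner_add_left, pinner_add_right, pinner_smul_left, pinner_smul_right, pinner_two_vecCons,
    pinner_pd_self hx hone, pinner_comm (pd i x u) (x u), h1]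
  ring

/-- The orthogonal complement of `(1, x)`, the `(0, ∂ₖx)` and `(0, ν)` is spanned by `(1, x)`. -/
lemma eq_smul_of_orthogonal {y : Fin (m + 2) → ℝ} {e : Fin m → Fin (m + 2) → ℝ}
    (hdet : (Matrix.of fun i j => pinner 1 (e i) (e j)).det ≠ 0) (hy : pinner 1 y y = 1)
    (hye : ∀ i, pinner 1 y (e i) = 0) (hν : pinner 1 ν ν = -1) (hνy : pinner 1 ν y = 0)
    (hνe : ∀ i, pinner 1 ν (e i) = 0) {Z : Fin (m + 2 + 1) → ℝ}
    (hZy : pinner 2 Z (Matrix.vecCons 1 y) = 0) (hZe : ∀ i, pinner 2 Z (Matrix.vecCons 0 (e i)) = 0)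
    (hZν : pinner 2 Z (Matrix.vecCons 0 ν) = 0) : Z = Z 0 • Matrix.vecCons 1 y := by
  obtain ⟨a, w, rfl⟩ : ∃ a w, Z = Matrix.vecCons a w :=
    ⟨Matrix.vecHead Z, Matrix.vecTail Z, (Matrix.cons_head_tail Z).symm⟩
  simp only [pinner_two_vecCons] at hZy hZe hZν
  have hw : w - a • y = 0 := by
    refine eq_zero_of_gram (s := 1) (ι := Fin m ⊕ Fin 2) (by simp) (Sum.elim e ![y, ν]) ?_ ?_
    · have : (Matrix.of fun i j => pinner 1 (Sum.elim e ![y, ν] i) (Sum.elim e ![y, ν] j)) =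
          Matrix.fromBlocks (Matrix.of fun i j => pinner 1 (e i) (e j)) 0 0 !![1, 0; 0, -1] := by
        ext (i | i) (j | j)
        · simp
        · fin_cases j <;> simp [pinner_comm (e i), hye, hνe]
        · fin_cases i <;> simp [hye, hνe]
        · fin_cases i <;> fin_cases j <;> simp [hy, hν, hνy, pinner_comm y ν]
      rw [this, Matrix.det_fromBlocks_zero₁₂]
      refine mul_ne_zero hdet ?_
      simp
    · rintro (i | i)
      · have := hZe i
        simp only [Sum.elim_inl, pinner_sub_left, pinner_smul_left, hye]
        linarith
      · fin_cases i
        · simp [hy]; linarith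
        · simp [pinner_comm y ν, hνy]; linarith
  have hw' : w = a • y := sub_eq_zero.mp hw
  simp [hw']

/-- Pairing `λ (1, x)` and its covariant second derivatives with a vector orthogonal to `(1, x)` and
to the `(0, ∂ₖx)` only sees the second derivatives of `x`. -/
lemma pinner_covHess_coneMap (hx : ContDiffAt ℝ 2 x u) (hl : ContDiffAt ℝ 2 l u)
    {W : Fin (m + 2 + 1) → ℝ} (hW : pinner 2 W (Matrix.vecCons 1 (x u)) = 0)
    (hW' : ∀ k, pinner 2 W (Matrix.vecCons 0 (pd k x u)) = 0) (i j : Fin m) :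
    pinner 2 W (covHess 2 (coneMap l x) i j u) =
      l u * pinner 2 W (Matrix.vecCons 0 (pd i (pd j x) u)) := by
  have hk : ∀ k, pinner 2 W (pd k (coneMap l x) u) = 0 := by
    intro k
    rw [pd_coneMap (hx.differentiableAt (by norm_num)) (hl.differentiableAt (by norm_num))]
    simp only [pinner_add_right, pinner_smul_right, hW, hW', mul_zero, add_zero]
  rw [covHess, pinner_sub_right, pinner_sum_right, pd_pd_coneMap hx hl]
  simp only [pinner_add_right, pinner_smul_right, hW, hW', hk, mul_zero, add_zero,
    Finset.sum_const_zero, sub_zero]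

lemma inv_metricCoeff_coneMap (hx : DifferentiableAt ℝ x u) (hl : DifferentiableAt ℝ l u)
    (hl0 : l u ≠ 0) (hone : ∀ᶠ z in nhds u, pinner 1 (x z) (x z) = 1)
    (hdet : (metricCoeff 1 x u).det ≠ 0) :
    (metricCoeff 2 (coneMap l x) u)⁻¹ = ((l u ^ 2)⁻¹) • (metricCoeff 1 x u)⁻¹ := by
  rw [metricCoeff_coneMap hx hl hone]
  refine Matrix.inv_eq_right_inv ?_
  rw [Matrix.smul_mul, Matrix.mul_smul, smul_smul,
    Matrix.mul_nonsing_inv _ (isUnit_iff_ne_zero.mpr hdet), mul_inv_cancel₀ (pow_ne_zero 2 hl0),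
    one_smul]

lemma det_metricCoeff_coneMap (hx : DifferentiableAt ℝ x u) (hl : DifferentiableAt ℝ l u)
    (hl0 : l u ≠ 0) (hone : ∀ᶠ z in nhds u, pinner 1 (x z) (x z) = 1)
    (hdet : (metricCoeff 1 x u).det ≠ 0) : (metricCoeff 2 (coneMap l x) u).det ≠ 0 := by
  rw [metricCoeff_coneMap hx hl hone, Matrix.det_smul]
  exact mul_ne_zero (pow_ne_zero _ (pow_ne_zero 2 hl0)) hdet

/-- The vector `a (1, x) + (0, ν)` is orthogonal to the Laplacian of `λ (1, x)` exactly for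
`a = -H`. -/
lemma pinner_laplacian_coneMap (hx : ContDiffAt ℝ 2 x u) (hl : ContDiffAt ℝ 2 l u)
    (hl0 : l u ≠ 0) (hone : ∀ᶠ z in nhds u, pinner 1 (x z) (x z) = 1)
    (hdet : (metricCoeff 1 x u).det ≠ 0) (hνx : pinner 1 ν (x u) = 0)
    (hνdx : ∀ k, pinner 1 ν (pd k x u) = 0) (a : ℝ) :
    pinner 2 (Matrix.vecCons a (a • x u + ν))
        (laplacian (metricCoeff 2 (coneMap l x)) (coneMap l x) u) =
      -(l u)⁻¹ * (m * a + trace₂ (metricCoeff 1 x u)⁻¹ (sff x ν u)) := by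
  have hxd := hx.differentiableAt (by norm_num)
  have hld := hl.differentiableAt (by norm_num)
  have hT : ∀ i j, pinner 2 (Matrix.vecCons a (a • x u + ν)) (covHess 2 (coneMap l x) i j u) =
      -l u * (a * metricCoeff 1 x u i j + sff x ν u i j) := by
    intro i j
    rw [pinner_covHess_coneMap hx hl]
    · simp [pinner_pd_pd_self hx hone, sff, pinner_comm ν]
      ring
    · simp [hone.self_of_nhds, hνx]
    · intro k
      simp [hνdx, pinner_pd_self hxd hone]
  rw [laplacian_eq_sum_covHess]
  simp only [pinner_sum_right, pinner_smul_right, hT,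
    inv_metricCoeff_coneMap hxd hld hl0 hone hdet, Matrix.smul_apply, smul_eq_mul]
  have hterm : ∀ i j, (l u ^ 2)⁻¹ * (metricCoeff 1 x u)⁻¹ i j *
      (-l u * (a * metricCoeff 1 x u i j + sff x ν u i j)) =
      -(l u)⁻¹ * (a * ((metricCoeff 1 x u)⁻¹ i j * metricCoeff 1 x u i j) +
        (metricCoeff 1 x u)⁻¹ i j * sff x ν u i j) := by
    intro i j
    field_simp
  simp only [hterm, ← Finset.mul_sum, Finset.sum_add_distrib,
    sum_inv_mul_self (metricCoeff_isSymm 1 x u) hdet]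
  simp only [trace₂, smul_eq_mul]
  ring

/-- The conformal factor of `λ (1, x)` in terms of the second fundamental form of `x`: by the Gauss
equation it is a multiple of the squared length of the trace-free part of the covariant Hessian,
which up to multiples of the null vector `(1, x)` equals `λ (h - H g) (0, ν)`. -/
lemma conformalFactor_coneMap (hm : 2 ≤ m) (hx : ContDiffAt ℝ 3 x u) (hl : ContDiffAt ℝ 3 l u)
    (hl0 : l u ≠ 0) (hone : ∀ᶠ z in nhds u, pinner 1 (x z) (x z) = 1)
    (hdet : (metricCoeff 1 x u).det ≠ 0) (hν : pinner 1 ν ν = -1) (hνx : pinner 1 ν (x u) = 0)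
    (hνdx : ∀ k, pinner 1 ν (pd k x u) = 0) :
    pinner 2 (laplacian (metricCoeff 2 (coneMap l x)) (coneMap l x) u)
        (laplacian (metricCoeff 2 (coneMap l x)) (coneMap l x) u) -
      (m : ℝ) ^ 2 * normScalarCurvature (metricCoeff 2 (coneMap l x)) u =
    -((l u ^ 2)⁻¹ * ((m : ℝ) / ((m : ℝ) - 1) *
      (normSq (LinearMap.mul ℝ ℝ) (metricCoeff 1 x u)⁻¹ (sff x ν u) -
        (m : ℝ) * (1 / (m : ℝ) * trace₂ (metricCoeff 1 x u)⁻¹ (sff x ν u)) ^ 2))) := by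
  have hm0 : (m : ℝ) ≠ 0 := by positivity
  have hm1 : (m : ℝ) - 1 ≠ 0 := by
    have : (2 : ℝ) ≤ m := by exact_mod_cast hm
    linarith
  have hx2 : ContDiffAt ℝ 2 x u := hx.of_le (by norm_num)
  have hl2 : ContDiffAt ℝ 2 l u := hl.of_le (by norm_num)
  have hxd := hx.differentiableAt (by norm_num)
  have hld := hl.differentiableAt (by norm_num)
  have hfdet := det_metricCoeff_coneMap hxd hld hl0 hone hdet
  have hGi := inv_metricCoeff_coneMap hxd hld hl0 hone hdet
  have hG := metricCoeff_coneMap hxd hld hone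
  have hf := contDiffAt_coneMap hx hl
  have h1 := hone.self_of_nhds
  set g := metricCoeff 1 x u with hg
  set h := sff x ν u with hh
  set f := coneMap l x with hfdef
  set T : Fin m → Fin m → Fin (m + 2 + 1) → ℝ := fun i j => covHess 2 f i j u with hT
  set D := laplacian (metricCoeff 2 f) f u with hD
  have hDT : D = trace₂ (metricCoeff 2 f u)⁻¹ T := rfl
  set X : Fin (m + 2 + 1) → ℝ := Matrix.vecCons 1 (x u) with hX
  set n : Fin (m + 2 + 1) → ℝ := Matrix.vecCons 0 ν with hn
  have hnn : pinner 2 n n = -1 := by simp [hn, hν]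
  have hnX : pinner 2 n X = 0 := by simp [hn, hX, hνx]
  have hXX : pinner 2 X X = 0 := by simp [hX, h1]
  have hXe : ∀ k, pinner 2 X (Matrix.vecCons 0 (pd k x u)) = 0 := by
    intro k; simp [hX, pinner_pd_self hxd hone]
  have hne : ∀ k, pinner 2 n (Matrix.vecCons 0 (pd k x u)) = 0 := by
    intro k; simp [hn, hνdx]
  have hTn : ∀ i j, pinner 2 n (T i j) = -l u * h i j := by
    intro i j
    rw [hT, pinner_covHess_coneMap hx2 hl2 hnX hne]
    simp [hn, hh, sff, pinner_comm ν]
  have hTX : ∀ i j, pinner 2 X (T i j) = -l u * g i j := by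
    intro i j
    rw [hT, pinner_covHess_coneMap hx2 hl2 hXX hXe]
    simp [hX, hg, pinner_pd_pd_self hx2 hone]
  have hDn : pinner 2 n D = -(l u)⁻¹ * trace₂ g⁻¹ h := by
    have := pinner_laplacian_coneMap hx2 hl2 hl0 hone hdet hνx hνdx 0
    simpa [hn, hD] using this
  have hDX : pinner 2 X D = -(l u)⁻¹ * m := by
    rw [hDT, hGi]
    simp only [trace₂, pinner_sum_right, pinner_smul_right, hTX, Matrix.smul_apply, smul_eq_mul]
    rw [← sum_inv_mul_self (metricCoeff_isSymm 1 x u) hdet]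
    simp only [Finset.mul_sum]
    refine Finset.sum_congr rfl fun i _ => Finset.sum_congr rfl fun j _ => ?_
    rw [← hg]
    field_simp
  -- `E` and `h0` are the trace-free parts of the covariant Hessian and of `h`.
  set E : Fin m → Fin m → Fin (m + 2 + 1) → ℝ := fun i j =>
    T i j - (1 / (m : ℝ) * metricCoeff 2 f u i j) • D with hE
  set h0 : Fin m → Fin m → ℝ := fun i j => h i j - (1 / (m : ℝ) * g i j) • trace₂ g⁻¹ h with hh0
  have hEn : ∀ i j, pinner 2 n (E i j) = -(l u * h0 i j) := by
    intro i j
    simp only [hE, hh0, pinner_sub_right, pinner_smul_right, hTn, hDn, hG, Matrix.smul_apply,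
      smul_eq_mul]
    field_simp
    ring
  have hEX : ∀ i j, pinner 2 X (E i j) = 0 := by
    intro i j
    simp only [hE, pinner_sub_right, pinner_smul_right, hTX, hDX, hG, Matrix.smul_apply,
      smul_eq_mul]
    field_simp
    ring
  have hTe : ∀ k i j, pinner 2 (pd k f u) (T i j) = 0 := by
    intro k i j
    rw [pinner_comm]
    exact pinner_covHess_pd (hf.of_le (by norm_num)) hfdet i j k
  have hDe : ∀ k, pinner 2 (pd k f u) D = 0 := by
    intro k
    simp only [hDT, trace₂, pinner_sum_right, pinner_smul_right, hTe, mul_zero,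
      Finset.sum_const_zero]
  have hEe : ∀ k i j, pinner 2 (Matrix.vecCons 0 (pd k x u)) (E i j) = 0 := by
    intro k i j
    have hz : pinner 2 (pd k f u) (E i j) = 0 := by
      simp only [hE, pinner_sub_right, pinner_smul_right, hTe, hDe, mul_zero, sub_zero]
    rw [hfdef, pd_coneMap hxd hld, pinner_add_left, pinner_smul_left, pinner_smul_left, hEX,
      mul_zero, add_zero] at hz
    exact (mul_eq_zero.mp hz).resolve_left hl0
  -- `E - λ h0 (0, ν)` is orthogonal to `(1, x)`, the `(0, ∂ₖx)` and `(0, ν)`, hence a multiple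
  -- of the null vector `(1, x)`, which does not contribute to inner products.
  have hEdec : ∀ i j, ∃ ζ : ℝ, E i j = ζ • X + (l u * h0 i j) • n := by
    intro i j
    refine ⟨(E i j - (l u * h0 i j) • n) 0, ?_⟩
    rw [← eq_smul_of_orthogonal (y := x u) (ν := ν) (e := fun k => pd k x u)
      (Z := E i j - (l u * h0 i j) • n) hdet h1 (pinner_pd_self hxd hone) hν hνx hνdx]
    · abel
    · rw [pinner_comm, pinner_sub_right, hEX, pinner_smul_right, pinner_comm, hnX]; ring
    · intro k
      rw [pinner_comm, pinner_sub_right, hEe, pinner_smul_right, pinner_comm, hne]; ring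
    · rw [pinner_comm, pinner_sub_right, hEn, pinner_smul_right, hnn]; ring
  have hEE : ∀ i j k p, pinner 2 (E i j) (E k p) = -(l u ^ 2) * (h0 i j * h0 k p) := by
    intro i j k p
    obtain ⟨ζ, h1⟩ := hEdec i j
    obtain ⟨ζ', h2⟩ := hEdec k p
    rw [h1, h2]
    simp only [pinner_add_left, pinner_add_right, pinner_smul_left, pinner_smul_right, hXX, hnX,
      pinner_comm X n, hnn]
    ring
  have hm00 : m ≠ 0 := by omega
  have hQE := normSq_sub_trace hm00 (metricCoeff_isSymm 2 f u) hfdet (pinnerL 2 (m + 2 + 1)) T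
  have hQh := normSq_sub_trace hm00 (metricCoeff_isSymm 1 x u) hdet (LinearMap.mul ℝ ℝ) h
  rw [← hDT] at hQE
  have hQ : normSq (pinnerL 2 (m + 2 + 1)) (metricCoeff 2 f u)⁻¹ E =
      -(l u ^ 2)⁻¹ * normSq (LinearMap.mul ℝ ℝ) g⁻¹ h0 := by
    rw [hGi]
    simp only [normSq, pinnerL_apply, hEE, Finset.mul_sum, Matrix.smul_apply, smul_eq_mul,
      LinearMap.mul_apply']
    refine Finset.sum_congr rfl fun i _ => Finset.sum_congr rfl fun j _ =>
      Finset.sum_congr rfl fun k _ => Finset.sum_congr rfl fun p _ => ?_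
    field_simp
  have hgauss := sum_inv_mul_riemannCoeff hf hfdet
  rw [normScalarCurvature, hgauss]
  have hT2 : ∑ i, ∑ j, ∑ k, ∑ l, (metricCoeff 2 f u)⁻¹ i k * (metricCoeff 2 f u)⁻¹ j l *
      pinner 2 (covHess 2 f i j u) (covHess 2 f k l u) =
      normSq (pinnerL 2 (m + 2 + 1)) (metricCoeff 2 f u)⁻¹ T := rfl
  rw [hT2, ← hD]
  have hQE' : normSq (pinnerL 2 (m + 2 + 1)) (metricCoeff 2 f u)⁻¹ T =
      1 / (m : ℝ) * pinner 2 D D + -(l u ^ 2)⁻¹ * normSq (LinearMap.mul ℝ ℝ) g⁻¹ h0 := by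
    rw [← hQ]
    simp only [pinnerL_apply] at hQE
    linarith
  have hQh' : normSq (LinearMap.mul ℝ ℝ) g⁻¹ h0 = normSq (LinearMap.mul ℝ ℝ) g⁻¹ h -
      1 / (m : ℝ) * (trace₂ g⁻¹ h * trace₂ g⁻¹ h) := hQh
  rw [hQE', hQh']
  field_simp
  ring

end LightCone

/-! ### Invariance under linear isometries and locality -/

section Congr

variable {m : ℕ} {F : Type*} [NormedAddCommGroup F] [NormedSpace ℝ F]
  {u : EuclideanSpace ℝ (Fin m)} {G G' : EuclideanSpace ℝ (Fin m) → Matrix (Fin m) (Fin m) ℝ}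
  {f f' : EuclideanSpace ℝ (Fin m) → F}

lemma christoffel_congr (hG : G =ᶠ[nhds u] G') (k i j : Fin m) :
    christoffel G k i j u = christoffel G' k i j u := by
  have h : ∀ a b c, pd c (fun z => G z a b) u = pd c (fun z => G' z a b) u := fun a b c =>
    pd_congr (hG.mono fun z hz => by simp only [hz]) c
  simp only [christoffel, h, hG.eq_of_nhds]

lemma christoffel_congr_eventually (hG : G =ᶠ[nhds u] G') (k i j : Fin m) :
    christoffel G k i j =ᶠ[nhds u] christoffel G' k i j := by
  filter_upwards [hG.eventuallyEq_nhds] with z hz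
  exact christoffel_congr hz k i j

lemma laplacian_congr (hG : G =ᶠ[nhds u] G') (hf : f =ᶠ[nhds u] f') :
    laplacian G f u = laplacian G' f' u := by
  have h2 : ∀ i j, pd i (pd j f) u = pd i (pd j f') u := fun i j =>
    pd_congr (pd_congr_eventually hf j) i
  simp only [laplacian, h2, pd_congr hf, christoffel_congr hG, hG.eq_of_nhds]

lemma normScalarCurvature_congr (hG : G =ᶠ[nhds u] G') :
    normScalarCurvature G u = normScalarCurvature G' u := by
  have h : ∀ a l i j, pd a (christoffel G l i j) u = pd a (christoffel G' l i j) u :=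
    fun a l i j => pd_congr (christoffel_congr_eventually hG l i j) a
  simp only [normScalarCurvature, riemannCoeff, h, christoffel_congr hG, hG.eq_of_nhds]

lemma pd_clequiv (L : F ≃L[ℝ] F) (i : Fin m) : pd i (L ∘ f) = L ∘ pd i f := by
  ext z
  rw [pd, L.comp_fderiv]
  rfl

lemma laplacian_clequiv (L : F ≃L[ℝ] F) : laplacian G (L ∘ f) u = L (laplacian G f u) := by
  simp only [laplacian, pd_clequiv, Function.comp_apply, map_sum, map_smul, map_sub]

lemma metricCoeff_clequiv {s n : ℕ} {f : EuclideanSpace ℝ (Fin m) → Fin n → ℝ}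
    {L : (Fin n → ℝ) ≃L[ℝ] (Fin n → ℝ)} (hL : ∀ a b, pinner s (L a) (L b) = pinner s a b) :
    metricCoeff s (L ∘ f) = metricCoeff s f := by
  ext z i j
  simp only [metricCoeff, pd_clequiv, Function.comp_apply, Matrix.of_apply, hL]

lemma metricCoeff_congr {s n : ℕ} {f f' : EuclideanSpace ℝ (Fin m) → Fin n → ℝ}
    (hf : f =ᶠ[nhds u] f') : metricCoeff s f =ᶠ[nhds u] metricCoeff s f' := by
  filter_upwards [hf.eventuallyEq_nhds] with z hz
  ext i j
  simp only [metricCoeff, pd_congr hz, Matrix.of_apply]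

end Congr

section Isometry

variable {m : ℕ} {M : Type*} [TopologicalSpace M] [ChartedSpace (EuclideanSpace ℝ (Fin m)) M]
  {n : ℕ} {p : M}

lemma tendsto_symm_coord (p : M) :
    Filter.Tendsto (extChartAt (𝓡 m) p).symm (nhds (coord p)) (nhds p) := by
  have := (continuousAt_extChartAt_symm (I := 𝓡 m) p).tendsto
  rwa [extChartAt_to_inv] at this

lemma inChart_congr {f f' : M → Fin n → ℝ} (h : f =ᶠ[nhds p] f') :
    inChart (m := m) f p =ᶠ[nhds (coord p)] inChart f' p :=
  (tendsto_symm_coord p).eventually h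

lemma inChart_coord (f : M → Fin n → ℝ) (p : M) : inChart (m := m) f p (coord p) = f p := by
  simp [inChart, coord]

lemma diff_eq_fderiv {f : M → Fin n → ℝ} (hf : MDifferentiableAt (𝓡 m) 𝓘(ℝ, Fin n → ℝ) f p)
    (v : TangentSpace (𝓡 m) p) :
    diff f p v = fderiv ℝ (inChart (m := m) f p) (coord p) v := by
  refine (DFunLike.congr_fun hf.mfderiv v).trans ?_
  change fderivWithin ℝ (inChart (m := m) f p) (Set.range (𝓡 m)) (coord p) v = _
  rw [ModelWithCorners.range_eq_univ, fderivWithin_univ]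

lemma diff_of_not {f : M → Fin n → ℝ} (hf : ¬ MDifferentiableAt (𝓡 m) 𝓘(ℝ, Fin n → ℝ) f p)
    (v : TangentSpace (𝓡 m) p) : diff f p v = 0 := by
  unfold diff
  rw [mfderiv_zero_of_not_mdifferentiableAt hf]
  rfl

variable {L : (Fin n → ℝ) ≃L[ℝ] (Fin n → ℝ)}

lemma inChart_clequiv {Y Y' : M → Fin n → ℝ} (h : Y =ᶠ[nhds p] L ∘ Y') :
    inChart (m := m) Y p =ᶠ[nhds (coord p)] L ∘ inChart Y' p := inChart_congr h

/-- No differentiability is required: `Y` and `Y'` are differentiable at `p` simultaneously. -/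
lemma diff_clequiv {Y Y' : M → Fin n → ℝ} (h : Y =ᶠ[nhds p] L ∘ Y') (v : TangentSpace (𝓡 m) p) :
    diff Y p v = L (diff Y' p v) := by
  have hfwd : ∀ {L : (Fin n → ℝ) ≃L[ℝ] (Fin n → ℝ)} {Y Y' : M → Fin n → ℝ},
      Y =ᶠ[nhds p] L ∘ Y' → MDifferentiableAt (𝓡 m) 𝓘(ℝ, Fin n → ℝ) Y' p →
      MDifferentiableAt (𝓡 m) 𝓘(ℝ, Fin n → ℝ) Y p := by
    intro L Y Y' h hY'
    refine MDifferentiableAt.congr_of_eventuallyEq ?_ h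
    exact (L.differentiableAt.mdifferentiableAt).comp p hY'
  by_cases hY' : MDifferentiableAt (𝓡 m) 𝓘(ℝ, Fin n → ℝ) Y' p
  · rw [diff_eq_fderiv hY', diff_eq_fderiv (hfwd h hY'), (inChart_clequiv h).fderiv_eq,
      L.comp_fderiv]
    rfl
  · have hY : ¬ MDifferentiableAt (𝓡 m) 𝓘(ℝ, Fin n → ℝ) Y p := by
      refine fun hY => hY' (hfwd (L := L.symm) (Y' := Y) ?_ hY)
      filter_upwards [h] with q hq
      simp [hq]
    rw [diff_of_not hY', diff_of_not hY, map_zero]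

lemma diff2_clequiv {Y Y' : M → Fin n → ℝ} (h : Y =ᶠ[nhds p] L ∘ Y')
    (v w : TangentSpace (𝓡 m) p) : diff2 Y p v w = L (diff2 Y' p v w) := by
  have hev : (fun z => fderiv ℝ (inChart (m := m) Y p) z v) =ᶠ[nhds (coord p)]
      L ∘ fun z => fderiv ℝ (inChart (m := m) Y' p) z v := by
    filter_upwards [(inChart_clequiv h).eventuallyEq_nhds] with z hz
    rw [hz.fderiv_eq, L.comp_fderiv]
    rfl
  unfold diff2
  rw [hev.fderiv_eq, L.comp_fderiv]
  rfl

lemma metricCoeff_inChart_clequiv {s : ℕ} (hL : ∀ a b, pinner s (L a) (L b) = pinner s a b)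
    {Y Y' : M → Fin n → ℝ} (h : Y =ᶠ[nhds p] L ∘ Y') :
    metricCoeff (m := m) s (inChart Y p) =ᶠ[nhds (coord p)] metricCoeff s (inChart Y' p) := by
  have := metricCoeff_congr (s := s) (inChart_clequiv (m := m) h)
  rwa [metricCoeff_clequiv hL] at this

variable (hL : ∀ a b, pinner 2 (L a) (L b) = pinner 2 a b)
include hL

lemma selfLaplacian_clequiv {Y Y' : M → Fin n → ℝ} (h : Y =ᶠ[nhds p] L ∘ Y') :
    selfLaplacian m Y p = L (selfLaplacian m Y' p) := by
  unfold selfLaplacian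
  rw [laplacian_congr (metricCoeff_inChart_clequiv hL h) (inChart_clequiv h), laplacian_clequiv]

lemma inducedKappa_clequiv {Y Y' : M → Fin n → ℝ} (h : Y =ᶠ[nhds p] L ∘ Y') :
    inducedKappa m Y p = inducedKappa m Y' p :=
  normScalarCurvature_congr (metricCoeff_inChart_clequiv hL h)

lemma inducedForm_clequiv {Y Y' : M → Fin n → ℝ} (h : Y =ᶠ[nhds p] L ∘ Y')
    (v w : TangentSpace (𝓡 m) p) : inducedForm 2 Y p v w = inducedForm 2 Y' p v w := by
  simp only [inducedForm, diff_clequiv h, hL]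

end Isometry

section IsometryCone

variable {m : ℕ} {M : Type*} [TopologicalSpace M] [ChartedSpace (EuclideanSpace ℝ (Fin m)) M]
  {p : M} {L : (Fin (m + 3) → ℝ) ≃L[ℝ] (Fin (m + 3) → ℝ)}
  (hL : ∀ a b, pinner 2 (L a) (L b) = pinner 2 a b) {Y Y' ξ ξ' : M → Fin (m + 3) → ℝ}
include hL

lemma conformalMetric_clequiv (h : Y =ᶠ[nhds p] L ∘ Y') (v w : TangentSpace (𝓡 m) p) :
    conformalMetric Y p v w = conformalMetric Y' p v w := by
  simp only [conformalMetric, selfLaplacian_clequiv hL h, inducedKappa_clequiv hL h,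
    inducedForm_clequiv hL h, hL]

lemma vectorN_clequiv (h : Y =ᶠ[nhds p] L ∘ Y') : vectorN m Y p = L (vectorN m Y' p) := by
  simp only [vectorN, selfLaplacian_clequiv hL h, h.eq_of_nhds, hL, map_sub, map_smul,
    Function.comp_apply]

lemma blaschkeTensor_clequiv (h : Y =ᶠ[nhds p] L ∘ Y') (v w : TangentSpace (𝓡 m) p) :
    blaschkeTensor Y p v w = blaschkeTensor Y' p v w := by
  simp only [blaschkeTensor, diff2_clequiv h, vectorN_clequiv hL h, hL]

lemma conformalForm_clequiv (h : Y =ᶠ[nhds p] L ∘ Y') (hξ : ξ p = L (ξ' p))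
    (v : TangentSpace (𝓡 m) p) : conformalForm Y ξ p v = conformalForm Y' ξ' p v := by
  have hN : vectorN m Y =ᶠ[nhds p] L ∘ vectorN m Y' := by
    filter_upwards [h.eventuallyEq_nhds] with q hq
    exact vectorN_clequiv hL hq
  simp only [conformalForm, diff_clequiv hN, hξ, hL]

lemma conformalSFF_clequiv (h : Y =ᶠ[nhds p] L ∘ Y') (hξ : ξ p = L (ξ' p))
    (v w : TangentSpace (𝓡 m) p) : conformalSFF Y ξ p v w = conformalSFF Y' ξ' p v w := by
  simp only [conformalSFF, diff2_clequiv h, hξ, hL]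

end IsometryCone

/-! ### Change of charts and smoothness of the invariants -/

section ChangeOfBasis

variable {m : ℕ} {G G' J : Matrix (Fin m) (Fin m) ℝ}

lemma det_ne_zero_of_congr (hG' : G' = J.transpose * G * J) (hdet : G'.det ≠ 0) :
    J.det ≠ 0 ∧ G.det ≠ 0 := by
  rw [hG', Matrix.det_mul, Matrix.det_mul] at hdet
  exact ⟨right_ne_zero_of_mul hdet, right_ne_zero_of_mul (left_ne_zero_of_mul hdet)⟩

lemma mul_inv_mul_transpose_of_congr (hG' : G' = J.transpose * G * J) (hdet : G'.det ≠ 0) :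
    J * G'⁻¹ * J.transpose = G⁻¹ := by
  obtain ⟨hJ, -⟩ := det_ne_zero_of_congr hG' hdet
  have hJu : IsUnit J.det := isUnit_iff_ne_zero.mpr hJ
  have hJt : IsUnit J.transpose.det := by rwa [Matrix.det_transpose]
  rw [hG', Matrix.mul_inv_rev, Matrix.mul_inv_rev, ← Matrix.mul_assoc,
    Matrix.mul_nonsing_inv _ hJu, Matrix.one_mul, Matrix.mul_assoc,
    Matrix.nonsing_inv_mul _ hJt, Matrix.mul_one]

lemma trace₂_of_congr {V : Type*} [AddCommGroup V] [Module ℝ V]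
    (hG' : G' = J.transpose * G * J) (hdet : G'.det ≠ 0) {T T' : Fin m → Fin m → V}
    (hT : ∀ i j, T' i j = ∑ k, ∑ l, (J k i * J l j) • T k l) :
    trace₂ G'⁻¹ T' = trace₂ G⁻¹ T := by
  unfold trace₂
  simp only [← mul_inv_mul_transpose_of_congr hG' hdet, hT, Finset.smul_sum, Matrix.mul_apply,
    Finset.sum_smul, Finset.sum_mul, Matrix.transpose_apply]
  have h : ∀ i j k l, G'⁻¹ i j • (J k i * J l j) • T k l = (J k i * G'⁻¹ i j * J l j) • T k l := by
    intro i j k l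
    rw [smul_smul]
    congr 1
    ring
  simp only [h]
  rw [(Finset.sum_congr rfl fun i _ => sum_rotate _).trans (sum_rotate _)]
  exact Finset.sum_congr rfl fun k _ => Finset.sum_congr rfl fun l _ => Finset.sum_comm

lemma normSq_mul_eq_trace (Gi A : Matrix (Fin m) (Fin m) ℝ) :
    normSq (LinearMap.mul ℝ ℝ) Gi A = (Gi.transpose * A * Gi * A.transpose).trace := by
  simp only [normSq, LinearMap.mul_apply', Matrix.trace, Matrix.diag_apply, Matrix.mul_apply,
    Matrix.transpose_apply, Finset.sum_mul]
  rw [Finset.sum_congr rfl fun i _ => Finset.sum_comm, Finset.sum_comm]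
  refine Finset.sum_congr rfl fun k _ => ?_
  rw [Finset.sum_congr rfl fun i _ => Finset.sum_comm, Finset.sum_comm]
  refine Finset.sum_congr rfl fun l _ => ?_
  rw [Finset.sum_comm]
  exact Finset.sum_congr rfl fun j _ => Finset.sum_congr rfl fun i _ => by ring

lemma normSq_of_congr (hG' : G' = J.transpose * G * J) (hdet : G'.det ≠ 0)
    {A A' : Matrix (Fin m) (Fin m) ℝ} (hA' : A' = J.transpose * A * J) :
    normSq (LinearMap.mul ℝ ℝ) G'⁻¹ A' = normSq (LinearMap.mul ℝ ℝ) G⁻¹ A := by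
  rw [normSq_mul_eq_trace, normSq_mul_eq_trace, ← mul_inv_mul_transpose_of_congr hG' hdet, hA']
  simp only [Matrix.transpose_mul, Matrix.transpose_transpose]
  simp only [← Matrix.mul_assoc]
  rw [Matrix.trace_mul_comm]
  simp only [← Matrix.mul_assoc]

end ChangeOfBasis

section Charts

variable {m : ℕ}

lemma contDiffAt_pd_top {F : Type*} [NormedAddCommGroup F] [NormedSpace ℝ F]
    {f : EuclideanSpace ℝ (Fin m) → F} {u : EuclideanSpace ℝ (Fin m)} (hf : ContDiffAt ℝ ∞ f u)
    (i : Fin m) : ContDiffAt ℝ ∞ (pd i f) u := contDiffAt_pd hf (by simp) i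

lemma fderiv_eq_sum_pd {F : Type*} [NormedAddCommGroup F] [NormedSpace ℝ F]
    (f : EuclideanSpace ℝ (Fin m) → F) (u v : EuclideanSpace ℝ (Fin m)) :
    fderiv ℝ f u v = ∑ k, v k • pd k f u := by
  conv_lhs => rw [← (EuclideanSpace.basisFun (Fin m) ℝ).sum_repr v]
  simp [pd]

variable {M : Type*} [TopologicalSpace M] [ChartedSpace (EuclideanSpace ℝ (Fin m)) M] {n : ℕ}
  {p q : M}

lemma eventually_mem_source (p : M) : ∀ᶠ q in nhds p, q ∈ (extChartAt (𝓡 m) p).source :=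
  extChartAt_source_mem_nhds p

lemma mdifferentiableAt_of_smooth {f : M → Fin n → ℝ}
    (hf : ContMDiffAt (𝓡 m) 𝓘(ℝ, Fin n → ℝ) ∞ f p) :
    MDifferentiableAt (𝓡 m) 𝓘(ℝ, Fin n → ℝ) f p := hf.mdifferentiableAt (by simp)

lemma diff_eq_sum_pd {f : M → Fin n → ℝ} (hf : ContMDiffAt (𝓡 m) 𝓘(ℝ, Fin n → ℝ) ∞ f p)
    (v : EuclideanSpace ℝ (Fin m)) :
    diff (m := m) f p v = ∑ k, v k • pd k (inChart f p) (coord p) :=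
  (diff_eq_fderiv (mdifferentiableAt_of_smooth hf) v).trans (fderiv_eq_sum_pd _ _ _)

lemma diff_single {f : M → Fin n → ℝ} (hf : ContMDiffAt (𝓡 m) 𝓘(ℝ, Fin n → ℝ) ∞ f p)
    (i : Fin m) :
    diff (m := m) f p (EuclideanSpace.single i (1 : ℝ)) = pd i (inChart f p) (coord p) :=
  diff_eq_fderiv (mdifferentiableAt_of_smooth hf) _

lemma inducedForm_eq_sum {s : ℕ} {f : M → Fin n → ℝ}
    (hf : ContMDiffAt (𝓡 m) 𝓘(ℝ, Fin n → ℝ) ∞ f p) (v w : EuclideanSpace ℝ (Fin m)) :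
    inducedForm (m := m) s f p v w =
      ∑ i, ∑ j, v i * w j * metricCoeff s (inChart f p) (coord p) i j := by
  change pinner s (diff (m := m) f p v) (diff (m := m) f p w) = _
  rw [diff_eq_sum_pd hf v, diff_eq_sum_pd hf w]
  simp only [pinner_sum_left, pinner_sum_right, pinner_smul_left, pinner_smul_right, metricCoeff,
    Matrix.of_apply, Finset.mul_sum]
  rw [Finset.sum_comm]
  exact Finset.sum_congr rfl fun i _ => Finset.sum_congr rfl fun j _ => by ring

lemma posDef_of_isSpacelikeAt {s : ℕ} {f : M → Fin n → ℝ}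
    (hf : ContMDiffAt (𝓡 m) 𝓘(ℝ, Fin n → ℝ) ∞ f p) (hsp : IsSpacelikeAt m s f p) :
    (metricCoeff (m := m) s (inChart f p) (coord p)).PosDef := by
  refine Matrix.PosDef.of_dotProduct_mulVec_pos ?_ fun v hv => ?_
  · rw [Matrix.IsHermitian, Matrix.conjTranspose_eq_transpose_of_trivial]
    exact metricCoeff_isSymm _ _ _
  · have hv' : (WithLp.toLp 2 v : EuclideanSpace ℝ (Fin m)) ≠ 0 := fun h => hv (by
      ext i; simpa using congrArg (fun z : EuclideanSpace ℝ (Fin m) => z i) h)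
    have := hsp (WithLp.toLp 2 v) hv'
    rw [inducedForm_eq_sum hf] at this
    simpa [dotProduct, Matrix.mulVec, Finset.mul_sum, mul_assoc, mul_comm, mul_left_comm] using this

lemma det_ne_zero_of_isSpacelikeAt {s : ℕ} {f : M → Fin n → ℝ}
    (hf : ContMDiffAt (𝓡 m) 𝓘(ℝ, Fin n → ℝ) ∞ f p) (hsp : IsSpacelikeAt m s f p) :
    (metricCoeff (m := m) s (inChart f p) (coord p)).det ≠ 0 :=
  (posDef_of_isSpacelikeAt hf hsp).det_pos.ne'

variable [IsManifold (𝓡 m) ∞ M]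

lemma contDiffAt_inChart {f : M → Fin n → ℝ} (hq : q ∈ (extChartAt (𝓡 m) p).source)
    (hf : ContMDiffAt (𝓡 m) 𝓘(ℝ, Fin n → ℝ) ∞ f q) :
    ContDiffAt ℝ ∞ (inChart (m := m) f p) (extChartAt (𝓡 m) p q) := by
  have ht := (extChartAt (𝓡 m) p).map_source hq
  have h1 : ContMDiffAt 𝓘(ℝ, EuclideanSpace ℝ (Fin m)) (𝓡 m) ∞ (extChartAt (𝓡 m) p).symm
      (extChartAt (𝓡 m) p q) :=
    (contMDiffOn_extChartAt_symm p).contMDiffAt (extChartAt_target_mem_nhds' ht)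
  have h2 : ContMDiffAt (𝓡 m) 𝓘(ℝ, Fin n → ℝ) ∞ f
      ((extChartAt (𝓡 m) p).symm (extChartAt (𝓡 m) p q)) := by
    rwa [(extChartAt (𝓡 m) p).left_inv hq]
  exact (h2.comp _ h1).contDiffAt

lemma contDiffAt_inChart_self {f : M → Fin n → ℝ}
    (hf : ContMDiffAt (𝓡 m) 𝓘(ℝ, Fin n → ℝ) ∞ f p) :
    ContDiffAt ℝ ∞ (inChart (m := m) f p) (coord p) :=
  contDiffAt_inChart (mem_extChartAt_source p) hf

/-- The Jacobian matrix of the change of charts expresses the partial derivatives at `q` in the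
chart at `q` by those in the chart at `p`. -/
lemma exists_jacobian (hq : q ∈ (extChartAt (𝓡 m) p).source) :
    ∃ J : Matrix (Fin m) (Fin m) ℝ, ∀ {n : ℕ} (f : M → Fin n → ℝ),
      ContMDiffAt (𝓡 m) 𝓘(ℝ, Fin n → ℝ) ∞ f q → ∀ i,
      pd i (inChart f q) (coord q) = ∑ k, J k i • pd k (inChart f p) (extChartAt (𝓡 m) p q) := by
  let D : EuclideanSpace ℝ (Fin m) →L[ℝ] EuclideanSpace ℝ (Fin m) :=
    mfderiv (𝓡 m) 𝓘(ℝ, EuclideanSpace ℝ (Fin m)) (extChartAt (𝓡 m) p) q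
  refine ⟨Matrix.of fun k i => D (EuclideanSpace.single i 1) k, fun {n} f hf i => ?_⟩
  rw [← diff_single hf]
  have hF := (contDiffAt_inChart hq hf).differentiableAt (by simp)
  have hχ : MDifferentiableAt (𝓡 m) 𝓘(ℝ, EuclideanSpace ℝ (Fin m)) (extChartAt (𝓡 m) p) q :=
    (contMDiffAt_extChartAt' (n := ∞) (by simpa using hq)).mdifferentiableAt (by simp)
  have hev : f =ᶠ[nhds q] inChart f p ∘ extChartAt (𝓡 m) p := by
    filter_upwards [extChartAt_source_mem_nhds' hq] with r hr
    simp only [inChart, Function.comp_apply, (extChartAt (𝓡 m) p).left_inv hr]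
  have hcomp : HasMFDerivAt (𝓡 m) 𝓘(ℝ, Fin n → ℝ) f q
      ((fderiv ℝ (inChart f p) (extChartAt (𝓡 m) p q)).comp D) :=
    (hF.hasFDerivAt.hasMFDerivAt.comp q hχ.hasMFDerivAt).congr_of_eventuallyEq hev
  have : diff (m := m) f q (EuclideanSpace.single i (1 : ℝ)) =
      fderiv ℝ (inChart f p) (extChartAt (𝓡 m) p q) (D (EuclideanSpace.single i 1)) := by
    exact DFunLike.congr_fun hcomp.mfderiv _
  rw [this, fderiv_eq_sum_pd]
  rfl

omit [IsManifold (𝓡 m) ∞ M] in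
lemma metricCoeff_eq_congr {s : ℕ} {f : M → Fin n → ℝ} {J : Matrix (Fin m) (Fin m) ℝ}
    (hJ : ∀ i, pd i (inChart f q) (coord q) =
      ∑ k, J k i • pd k (inChart f p) (extChartAt (𝓡 m) p q)) :
    metricCoeff s (inChart f q) (coord q) =
      J.transpose * metricCoeff s (inChart f p) (extChartAt (𝓡 m) p q) * J := by
  ext i j
  simp only [metricCoeff, Matrix.of_apply, hJ, pinner_sum_left, pinner_sum_right, pinner_smul_left,
    pinner_smul_right, Matrix.mul_apply, Matrix.transpose_apply, Finset.sum_mul, Finset.mul_sum]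
  exact Finset.sum_congr rfl fun k _ => Finset.sum_congr rfl fun l _ => by ring

omit [IsManifold (𝓡 m) ∞ M] in
lemma contMDiffAt_of_eventually_chart {F : Type*} [NormedAddCommGroup F] [NormedSpace ℝ F]
    {a : M → F} {A : EuclideanSpace ℝ (Fin m) → F} (hA : ContDiffAt ℝ ∞ A (coord p))
    (h : ∀ᶠ q in nhds p, a q = A (extChartAt (𝓡 m) p q)) :
    ContMDiffAt (𝓡 m) 𝓘(ℝ, F) ∞ a p :=
  (ContMDiffAt.comp (f := extChartAt (𝓡 m) p) p hA.contMDiffAt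
    contMDiffAt_extChartAt).congr_of_eventuallyEq h

end Charts

section DeSitter

variable {m : ℕ} {M : Type*} [TopologicalSpace M] [ChartedSpace (EuclideanSpace ℝ (Fin m)) M]
  {x n : M → Fin (m + 2) → ℝ} {V : Set M} {p q : M} {ν : Fin (m + 2) → ℝ}

/-- `x` is a smooth space-like hypersurface of the de Sitter space on the open set `V`; regularity
is not required. -/
structure IsSpacelikeInDeSitter (x : M → (Fin (m + 2) → ℝ)) (V : Set M) : Prop where
  isOpen : IsOpen V
  smooth : ContMDiffOn (𝓡 m) 𝓘(ℝ, Fin (m + 2) → ℝ) ∞ x V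
  mem_deSitter : ∀ p ∈ V, pinner 1 (x p) (x p) = 1
  spacelike : ∀ p ∈ V, IsSpacelikeAt m 1 x p

namespace IsSpacelikeInDeSitter

lemma smoothAt (hx : IsSpacelikeInDeSitter x V) (hp : p ∈ V) :
    ContMDiffAt (𝓡 m) 𝓘(ℝ, Fin (m + 2) → ℝ) ∞ x p :=
  hx.smooth.contMDiffAt (hx.isOpen.mem_nhds hp)

lemma mono {V' : Set M} (hx : IsSpacelikeInDeSitter x V) (hV' : IsOpen V') (h : V' ⊆ V) :
    IsSpacelikeInDeSitter x V' :=
  ⟨hV', hx.smooth.mono h, fun p hp => hx.mem_deSitter p (h hp), fun p hp => hx.spacelike p (h hp)⟩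

lemma eventually_one (hx : IsSpacelikeInDeSitter x V) (hp : p ∈ V) :
    ∀ᶠ q in nhds p, pinner 1 (x q) (x q) = 1 :=
  Filter.mem_of_superset (hx.isOpen.mem_nhds hp) hx.mem_deSitter

lemma det_ne_zero (hx : IsSpacelikeInDeSitter x V) (hp : p ∈ V) :
    (metricCoeff (m := m) 1 (inChart x p) (coord p)).det ≠ 0 :=
  det_ne_zero_of_isSpacelikeAt (hx.smoothAt hp) (hx.spacelike p hp)

lemma pinner_pd (hx : IsSpacelikeInDeSitter x V) (hp : p ∈ V) (hν : IsUnitNormalAt x p ν)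
    (k : Fin m) : pinner 1 ν (pd k (inChart x p) (coord p)) = 0 := by
  rw [← diff_single (hx.smoothAt hp)]
  exact hν.2.2 _

end IsSpacelikeInDeSitter

lemma IsUnitNormal.smoothAt (hn : IsUnitNormal x V n) (hV : IsOpen V) (hp : p ∈ V) :
    ContMDiffAt (𝓡 m) 𝓘(ℝ, Fin (m + 2) → ℝ) ∞ n p :=
  hn.smooth.contMDiffAt (hV.mem_nhds hp)

/-- The matrix `⟨∂ᵢn, ∂ⱼx⟩₁`; for a unit normal field `n` it is the second fundamental form. -/
def weingarten (n x : EuclideanSpace ℝ (Fin m) → Fin (m + 2) → ℝ)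
    (u : EuclideanSpace ℝ (Fin m)) : Matrix (Fin m) (Fin m) ℝ :=
  Matrix.of fun i j => pinner 1 (pd i n u) (pd j x u)

variable [IsManifold (𝓡 m) ∞ M]

/-- A normal field is orthogonal to the partial derivatives of `x` in any chart. -/
lemma IsUnitNormal.pinner_pd_chart (hx : IsSpacelikeInDeSitter x V) (hn : IsUnitNormal x V n)
    (hq : q ∈ V) (hqs : q ∈ (extChartAt (𝓡 m) p).source) (k : Fin m) :
    pinner 1 (n q) (pd k (inChart x p) (extChartAt (𝓡 m) p q)) = 0 := by
  obtain ⟨J, hJ⟩ := exists_jacobian hqs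
  have hJx := hJ x (hx.smoothAt hq)
  have hdet := det_ne_zero_of_congr (metricCoeff_eq_congr (s := 1) hJx) (hx.det_ne_zero hq)
  have h0 : Matrix.vecMul (fun k => pinner 1 (n q) (pd k (inChart x p) (extChartAt (𝓡 m) p q))) J
      = 0 := by
    ext i
    have := hx.pinner_pd hq (hn.normal q hq) i
    rw [hJx, pinner_sum_right] at this
    simpa [Matrix.vecMul, dotProduct, mul_comm] using this
  exact congrFun (Matrix.eq_zero_of_vecMul_eq_zero hdet.1 h0) k

/-- The Weingarten equation. -/
lemma sffCoeff_eq_weingarten (hx : IsSpacelikeInDeSitter x V) (hn : IsUnitNormal x V n)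
    (hp : p ∈ V) :
    sffCoeff x p (n p) = weingarten (m := m) (inChart n p) (inChart x p) (coord p) := by
  ext i j
  have hxs := contDiffAt_inChart_self (hx.smoothAt hp)
  have hns := contDiffAt_inChart_self (hn.smoothAt hx.isOpen hp)
  have hev : (fun z => pinner 1 (inChart n p z) (pd j (inChart x p) z)) =ᶠ[nhds (coord (m := m) p)]
      fun _ => 0 := by
    filter_upwards [(tendsto_symm_coord p).eventually (hx.isOpen.mem_nhds hp),
      extChartAt_target_mem_nhds p] with z hz hzt
    have := hn.pinner_pd_chart hx hz ((extChartAt (𝓡 m) p).map_target hzt) j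
    rwa [(extChartAt (𝓡 m) p).right_inv hzt] at this
  have h := pd_congr hev i
  rw [pd_pinner (hns.differentiableAt (by simp))
    ((contDiffAt_pd_top hxs j).differentiableAt (by simp)),
    pd_const, inChart_coord] at h
  simp only [sffCoeff, weingarten, Matrix.of_apply]
  rw [pinner_comm]
  linarith

lemma contDiffAt_inv_metricCoeff {f : EuclideanSpace ℝ (Fin m) → Fin (m + 2) → ℝ}
    {u : EuclideanSpace ℝ (Fin m)} (hf : ContDiffAt ℝ ∞ f u) (hdet : (metricCoeff 1 f u).det ≠ 0)
    (i j : Fin m) : ContDiffAt ℝ ∞ (fun z => (metricCoeff 1 f z)⁻¹ i j) u :=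
  contDiffAt_inv_entry (fun a b => contDiffAt_metricCoeff hf (by simp) a b) hdet i j

/-- In a fixed chart the trace and the squared length of the second fundamental form are given by
first derivatives of `x` and of the normal field. -/
lemma curvature_eq_chart (hx : IsSpacelikeInDeSitter x V) (hn : IsUnitNormal x V n)
    (hq : q ∈ V) (hqs : q ∈ (extChartAt (𝓡 m) p).source) :
    meanCurvature x q (n q) = 1 / (m : ℝ) *
      trace₂ (metricCoeff 1 (inChart x p) (extChartAt (𝓡 m) p q))⁻¹
        (weingarten (inChart n p) (inChart x p) (extChartAt (𝓡 m) p q)) ∧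
    sffNormSq x q (n q) =
      normSq (LinearMap.mul ℝ ℝ) (metricCoeff 1 (inChart x p) (extChartAt (𝓡 m) p q))⁻¹
        (weingarten (inChart n p) (inChart x p) (extChartAt (𝓡 m) p q)) := by
  obtain ⟨J, hJ⟩ := exists_jacobian hqs
  have hJx := hJ x (hx.smoothAt hq)
  have hJn := hJ n (hn.smoothAt hx.isOpen hq)
  have hG := metricCoeff_eq_congr (s := 1) hJx
  have hdet := hx.det_ne_zero hq
  have hT : ∀ i j, sffCoeff x q (n q) i j = ∑ k, ∑ l, (J k i * J l j) •
      weingarten (inChart n p) (inChart x p) (extChartAt (𝓡 m) p q) k l := by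
    intro i j
    rw [sffCoeff_eq_weingarten hx hn hq]
    simp only [weingarten, Matrix.of_apply, hJx, hJn, pinner_sum_left, pinner_sum_right,
      pinner_smul_left, pinner_smul_right, smul_eq_mul, Finset.mul_sum, mul_assoc]
    rw [Finset.sum_comm]
    exact Finset.sum_congr rfl fun k _ => Finset.sum_congr rfl fun l _ => by ring
  have hA : sffCoeff x q (n q) = J.transpose *
      weingarten (inChart n p) (inChart x p) (extChartAt (𝓡 m) p q) * J := by
    ext i j
    rw [hT]
    simp only [Matrix.mul_apply, Matrix.transpose_apply, Finset.sum_mul, smul_eq_mul]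
    rw [Finset.sum_comm]
    exact Finset.sum_congr rfl fun k _ => Finset.sum_congr rfl fun l _ => by ring
  exact ⟨congrArg (1 / (m : ℝ) * ·) (trace₂_of_congr hG hdet hT), normSq_of_congr hG hdet hA⟩

lemma contDiffAt_weingarten {f g : EuclideanSpace ℝ (Fin m) → Fin (m + 2) → ℝ}
    {u : EuclideanSpace ℝ (Fin m)} (hf : ContDiffAt ℝ ∞ f u) (hg : ContDiffAt ℝ ∞ g u)
    (i j : Fin m) : ContDiffAt ℝ ∞ (fun z => weingarten f g z i j) u :=
  contDiffAt_pinner (contDiffAt_pd_top hf i) (contDiffAt_pd_top hg j)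

lemma contMDiffAt_meanCurvature (hx : IsSpacelikeInDeSitter x V) (hn : IsUnitNormal x V n)
    (hp : p ∈ V) : ContMDiffAt (𝓡 m) 𝓘(ℝ, ℝ) ∞ (fun q => meanCurvature x q (n q)) p := by
  have hxs := contDiffAt_inChart_self (hx.smoothAt hp)
  have hns := contDiffAt_inChart_self (hn.smoothAt hx.isOpen hp)
  refine contMDiffAt_of_eventually_chart (A := fun u => 1 / (m : ℝ) *
      trace₂ (metricCoeff 1 (inChart (m := m) x p) u)⁻¹
        (weingarten (inChart (m := m) n p) (inChart (m := m) x p) u)) ?_ ?_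
  · exact contDiffAt_const.mul (ContDiffAt.sum fun i _ => ContDiffAt.sum fun j _ =>
      (contDiffAt_inv_metricCoeff hxs (hx.det_ne_zero hp) i j).smul
        (contDiffAt_weingarten hns hxs i j))
  · filter_upwards [hx.isOpen.mem_nhds hp, eventually_mem_source (m := m) p] with q hq hqs
    exact (curvature_eq_chart hx hn hq hqs).1

lemma contMDiffAt_rhoSq (hx : IsSpacelikeInDeSitter x V) (hn : IsUnitNormal x V n)
    (hp : p ∈ V) : ContMDiffAt (𝓡 m) 𝓘(ℝ, ℝ) ∞ (fun q => rhoSq x q (n q)) p := by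
  have hxs := contDiffAt_inChart_self (hx.smoothAt hp)
  have hns := contDiffAt_inChart_self (hn.smoothAt hx.isOpen hp)
  have hN : ContMDiffAt (𝓡 m) 𝓘(ℝ, ℝ) ∞ (fun q => sffNormSq x q (n q)) p := by
    refine contMDiffAt_of_eventually_chart (A := fun u => normSq (LinearMap.mul ℝ ℝ)
      (metricCoeff 1 (inChart (m := m) x p) u)⁻¹
        (weingarten (inChart (m := m) n p) (inChart (m := m) x p) u)) ?_ ?_
    · have hi := contDiffAt_inv_metricCoeff hxs (hx.det_ne_zero hp)
      have hw := contDiffAt_weingarten hns hxs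
      exact ContDiffAt.sum fun i _ => ContDiffAt.sum fun j _ => ContDiffAt.sum fun k _ =>
        ContDiffAt.sum fun l _ => ((hi i k).mul (hi j l)).mul ((hw i j).mul (hw k l))
    · filter_upwards [hx.isOpen.mem_nhds hp, eventually_mem_source (m := m) p] with q hq hqs
      exact (curvature_eq_chart hx hn hq hqs).2
  have hH := contMDiffAt_meanCurvature hx hn hp
  exact contMDiffAt_const.mul (hN.sub (contMDiffAt_const.mul (hH.pow 2)))

/-! ### The unit normal field -/

/-- The component of the time-like vector `e₀` orthogonal to the hypersurface `x` and to its
position vector, computed from the position `y`, the derivatives `e` and the inverse metric. -/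
def normalComponent (Gi : Matrix (Fin m) (Fin m) ℝ) (y : Fin (m + 2) → ℝ)
    (e : Fin m → Fin (m + 2) → ℝ) : Fin (m + 2) → ℝ :=
  Pi.single 0 1 - pinner 1 (Pi.single 0 1) y • y -
    trace₂ Gi fun i j => pinner 1 (Pi.single 0 1) (e i) • e j

omit [IsManifold (𝓡 m) ∞ M] in
lemma normalComponent_spec {G : Matrix (Fin m) (Fin m) ℝ} (hG : G.PosDef) {y : Fin (m + 2) → ℝ}
    {e : Fin m → Fin (m + 2) → ℝ} (hGe : ∀ i j, G i j = pinner 1 (e i) (e j))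
    (hy : pinner 1 y y = 1) (hye : ∀ i, pinner 1 y (e i) = 0) :
    pinner 1 (normalComponent G⁻¹ y e) y = 0 ∧ (∀ k, pinner 1 (normalComponent G⁻¹ y e) (e k) = 0) ∧
      pinner 1 (normalComponent G⁻¹ y e) (normalComponent G⁻¹ y e) < 0 := by
  have hsymm : G.IsSymm := by
    ext i j
    rw [Matrix.transpose_apply, hGe, hGe, pinner_comm]
  set t : Fin (m + 2) → ℝ := Pi.single 0 1 with ht
  have htt : pinner 1 t t = -1 := by
    simp [pinner, ht, Fin.sum_univ_succ]
  have h1 : pinner 1 (normalComponent G⁻¹ y e) y = 0 := by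
    simp only [normalComponent, trace₂, pinner_sub_left, pinner_smul_left, pinner_sum_left,
      pinner_comm (e _) y, hye, hy, mul_zero, Finset.sum_const_zero, mul_one, sub_self]
  have h2 : ∀ k, pinner 1 (normalComponent G⁻¹ y e) (e k) = 0 := by
    intro k
    have h := sum_sum_inv_mul hsymm hG.det_pos.ne' (fun i => pinner 1 t (e i)) k
    have h3 : pinner 1 (trace₂ G⁻¹ fun i j => pinner 1 t (e i) • e j) (e k) = pinner 1 t (e k) := by
      rw [← h]
      simp only [trace₂, pinner_sum_left, pinner_smul_left, ← hGe, Finset.sum_mul]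
      rw [Finset.sum_comm]
      refine Finset.sum_congr rfl fun i _ => Finset.sum_congr rfl fun j _ => ?_
      rw [hsymm.inv.apply i j]
      ring
    simp only [normalComponent, pinner_sub_left, pinner_smul_left, hye, ← ht, h3]
    ring
  refine ⟨h1, h2, ?_⟩
  have h4 : pinner 1 (normalComponent G⁻¹ y e) (normalComponent G⁻¹ y e) =
      pinner 1 (normalComponent G⁻¹ y e) t := by
    change pinner 1 (normalComponent G⁻¹ y e)
      (t - pinner 1 t y • y - trace₂ G⁻¹ fun i j => pinner 1 t (e i) • e j) = _
    simp only [pinner_sub_right, pinner_smul_right, trace₂, pinner_sum_right, h1, h2, mul_zero,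
      Finset.sum_const_zero, sub_zero]
  rw [h4]
  have h5 : 0 ≤ ∑ i, ∑ j, G⁻¹ i j * (pinner 1 t (e i) * pinner 1 t (e j)) := by
    have := hG.inv.posSemidef.dotProduct_mulVec_nonneg (fun i => pinner 1 t (e i))
    simpa [dotProduct, Matrix.mulVec, Finset.mul_sum, mul_comm, mul_left_comm] using this
  simp only [normalComponent, pinner_sub_left, pinner_smul_left, trace₂, pinner_sum_left, ← ht, htt,
    pinner_comm y t, pinner_comm (e _) t]
  nlinarith [sq_nonneg (pinner 1 t y)]

/-- Projecting a fixed time-like vector to the normal line and normalizing yields a smooth unit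
normal field: the de Sitter space is time-oriented. -/
lemma exists_isUnitNormal (hx : IsSpacelikeInDeSitter x V) : ∃ n, IsUnitNormal x V n := by
  let N : M → Fin (m + 2) → ℝ := fun q =>
    normalComponent (metricCoeff 1 (inChart (m := m) x q) (coord q))⁻¹ (x q)
      fun i => pd i (inChart (m := m) x q) (coord q)
  have hspec : ∀ q ∈ V, pinner 1 (N q) (x q) = 0 ∧
      (∀ k, pinner 1 (N q) (pd k (inChart (m := m) x q) (coord q)) = 0) ∧
      pinner 1 (N q) (N q) < 0 := by
    intro q hq
    refine normalComponent_spec (posDef_of_isSpacelikeAt (hx.smoothAt hq) (hx.spacelike q hq))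
      (fun i j => rfl) (hx.mem_deSitter q hq) fun i => ?_
    have := pinner_pd_self ((contDiffAt_inChart_self (hx.smoothAt hq)).differentiableAt (by simp))
      ((tendsto_symm_coord q).eventually (hx.eventually_one hq)) i
    rwa [inChart_coord] at this
  have hNs : ∀ p ∈ V, ContMDiffAt (𝓡 m) 𝓘(ℝ, Fin (m + 2) → ℝ) ∞ N p := by
    intro p hp
    have hxs := contDiffAt_inChart_self (hx.smoothAt hp)
    refine contMDiffAt_of_eventually_chart (A := fun u =>
      normalComponent (metricCoeff 1 (inChart (m := m) x p) u)⁻¹ (inChart (m := m) x p u)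
        fun i => pd i (inChart (m := m) x p) u) ?_ ?_
    · refine (contDiffAt_const.sub ((contDiffAt_pinner contDiffAt_const hxs).smul hxs)).sub ?_
      exact ContDiffAt.sum fun i _ => ContDiffAt.sum fun j _ =>
        (contDiffAt_inv_metricCoeff hxs (hx.det_ne_zero hp) i j).smul
          ((contDiffAt_pinner contDiffAt_const (contDiffAt_pd_top hxs i)).smul
            (contDiffAt_pd_top hxs j))
    · filter_upwards [hx.isOpen.mem_nhds hp, eventually_mem_source (m := m) p] with q hq hqs
      obtain ⟨J, hJ⟩ := exists_jacobian hqs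
      have hJx := hJ x (hx.smoothAt hq)
      have hxq : inChart (m := m) x p (extChartAt (𝓡 m) p q) = x q := by
        simp only [inChart, Function.comp_apply, (extChartAt (𝓡 m) p).left_inv hqs]
      simp only [N, normalComponent, hxq]
      congr 1
      refine trace₂_of_congr (metricCoeff_eq_congr (s := 1) hJx) (hx.det_ne_zero hq) fun i j => ?_
      simp only [hJx, pinner_sum_right, pinner_smul_right, Finset.sum_smul, Finset.smul_sum,
        Finset.sum_mul, smul_smul]
      rw [Finset.sum_comm]
      refine Finset.sum_congr rfl fun k _ => Finset.sum_congr rfl fun l _ => ?_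
      congr 1
      ring
  refine ⟨fun q => (Real.sqrt (-pinner 1 (N q) (N q)))⁻¹ • N q, fun p hp => ?_, fun p hp => ?_⟩
  · have hf : ContDiffAt ℝ ∞ (fun v : Fin (m + 2) → ℝ => (Real.sqrt (-pinner 1 v v))⁻¹ • v)
        (N p) := by
      have hneg : 0 < -pinner 1 (N p) (N p) := neg_pos.mpr (hspec p hp).2.2
      have hq : ContDiffAt ℝ ∞ (fun v : Fin (m + 2) → ℝ => -pinner 1 v v) (N p) :=
        ((((pinnerCLM 1 (m + 2)).contDiff).clm_apply contDiff_id).neg).contDiffAt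
      exact ((hq.sqrt hneg.ne').inv (Real.sqrt_pos.mpr hneg).ne').smul contDiffAt_id
    exact (hf.contMDiffAt.comp p (hNs p hp)).contMDiffWithinAt
  · obtain ⟨h1, h2, h3⟩ := hspec p hp
    refine ⟨?_, ?_, fun v => ?_⟩
    · have hs := Real.mul_self_sqrt (neg_pos.mpr h3).le
      have hs0 := (Real.sqrt_pos.mpr (neg_pos.mpr h3)).ne'
      simp only [pinner_smul_left, pinner_smul_right]
      field_simp
      rw [sq, hs]
      ring
    · simp [h1]
    · rw [pinner_smul_left]
      refine mul_eq_zero_of_right _ ?_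
      refine (congrArg (pinner 1 (N p)) (diff_eq_sum_pd (hx.smoothAt hp) v)).trans ?_
      simp [pinner_sum_right, h2]

end DeSitter

/-! ### The conformal position and light cone lifts -/

section Cone

variable {m : ℕ} {M : Type*} [TopologicalSpace M] [ChartedSpace (EuclideanSpace ℝ (Fin m)) M]
  {x n : M → Fin (m + 2) → ℝ} {l : M → ℝ} {V : Set M} {p : M} {ν : Fin (m + 2) → ℝ}

lemma smoothAt_vecCons {k : ℕ} {a : M → ℝ} {f : M → Fin k → ℝ}
    (ha : ContMDiffAt (𝓡 m) 𝓘(ℝ, ℝ) ∞ a p) (hf : ContMDiffAt (𝓡 m) 𝓘(ℝ, Fin k → ℝ) ∞ f p) :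
    ContMDiffAt (𝓡 m) 𝓘(ℝ, Fin (k + 1) → ℝ) ∞
      (fun q => (Matrix.vecCons (a q) (f q) : Fin (k + 1) → ℝ)) p := by
  rw [contMDiffAt_pi_space] at hf ⊢
  exact Fin.cases ha hf

lemma smoothAt_coneMap (hl : ContMDiffAt (𝓡 m) 𝓘(ℝ, ℝ) ∞ l p)
    (hx : ContMDiffAt (𝓡 m) 𝓘(ℝ, Fin (m + 2) → ℝ) ∞ x p) :
    ContMDiffAt (𝓡 m) 𝓘(ℝ, Fin (m + 3) → ℝ) ∞ (coneMap l x) p :=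
  hl.smul (smoothAt_vecCons contMDiffAt_const hx)

lemma exists_tangent_ne_zero (hm : 0 < m) (p : M) : ∃ v : TangentSpace (𝓡 m) p, v ≠ 0 := by
  have h : (EuclideanSpace.single (⟨0, hm⟩ : Fin m) (1 : ℝ)) ≠ 0 := by simp
  exact ⟨_, h⟩

lemma rhoSq_nonneg (hm : 2 ≤ m) (hx : IsSpacelikeInDeSitter x V) (hp : p ∈ V) :
    0 ≤ rhoSq x p ν := by
  have hm' : (2 : ℝ) ≤ m := by exact_mod_cast hm
  have hpd := posDef_of_isSpacelikeAt (hx.smoothAt hp) (hx.spacelike p hp)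
  have h := (normSq_mul_nonneg hpd.inv.posSemidef _).trans_eq
    (normSq_sub_trace (by omega) (metricCoeff_isSymm _ _ _) hpd.det_pos.ne' (LinearMap.mul ℝ ℝ)
      (fun i j => sffCoeff x p ν i j))
  have h2 : 0 ≤ sffNormSq x p ν - 1 / (m : ℝ) *
      (trace₂ (metricCoeff (m := m) 1 (inChart x p) (coord p))⁻¹ (sffCoeff x p ν) *
        trace₂ (metricCoeff (m := m) 1 (inChart x p) (coord p))⁻¹ (sffCoeff x p ν)) := h
  have h3 : meanCurvature x p ν = 1 / (m : ℝ) *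
      trace₂ (metricCoeff (m := m) 1 (inChart x p) (coord p))⁻¹ (sffCoeff x p ν) := rfl
  refine mul_nonneg (div_nonneg (by linarith) (by linarith)) ?_
  rw [h3]
  refine h2.trans (le_of_eq ?_)
  have : (m : ℝ) ≠ 0 := by linarith
  field_simp

variable [IsManifold (𝓡 m) ∞ M]

lemma contDiffAt_scalar_inChart (hl : ContMDiffAt (𝓡 m) 𝓘(ℝ, ℝ) ∞ l p) :
    ContDiffAt ℝ ∞ (l ∘ (extChartAt (𝓡 m) p).symm) (coord (m := m) p) := by
  have h1 : ContMDiffAt (𝓡 m) 𝓘(ℝ, Fin 1 → ℝ) ∞ (fun q => fun _ : Fin 1 => l q) p :=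
    contMDiffAt_pi_space.mpr fun _ => hl
  exact contDiffAt_pi.mp (contDiffAt_inChart_self h1) 0

lemma inducedForm_coneMap (hl : ContMDiffAt (𝓡 m) 𝓘(ℝ, ℝ) ∞ l p)
    (hx : ContMDiffAt (𝓡 m) 𝓘(ℝ, Fin (m + 2) → ℝ) ∞ x p)
    (hone : ∀ᶠ q in nhds p, pinner 1 (x q) (x q) = 1) (v w : TangentSpace (𝓡 m) p) :
    inducedForm 2 (coneMap l x) p v w = l p ^ 2 * inducedForm 1 x p v w := by
  have hxs := contDiffAt_inChart_self hx
  have hls := contDiffAt_scalar_inChart hl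
  refine (inducedForm_eq_sum (smoothAt_coneMap hl hx) v w).trans ?_
  refine Eq.trans ?_ (congrArg (l p ^ 2 * ·) (inducedForm_eq_sum hx v w)).symm
  have hG : metricCoeff (m := m) 2 (inChart (coneMap l x) p) (coord p) =
      (l p ^ 2) • metricCoeff 1 (inChart x p) (coord p) := by
    have := metricCoeff_coneMap (hxs.differentiableAt (by simp)) (hls.differentiableAt (by simp))
      ((tendsto_symm_coord p).eventually hone)
    rwa [Function.comp_apply, coord, extChartAt_to_inv] at this
  rw [hG]
  simp only [Matrix.smul_apply, smul_eq_mul, Finset.mul_sum]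
  exact Finset.sum_congr rfl fun i _ => Finset.sum_congr rfl fun j _ => by ring

namespace IsSpacelikeInDeSitter

variable (hx : IsSpacelikeInDeSitter x V) (hp : p ∈ V) (hl : ContMDiffAt (𝓡 m) 𝓘(ℝ, ℝ) ∞ l p)
include hx hp hl

/-- The conformal metric of `λ (1, x)` does not depend on `λ`. -/
lemma conformalMetric_coneMap (hm : 2 ≤ m) (hl0 : l p ≠ 0) (hν : IsUnitNormalAt x p ν)
    (v w : TangentSpace (𝓡 m) p) :
    conformalMetric (coneMap l x) p v w = rhoSq x p ν * inducedForm 1 x p v w := by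
  have hxs := contDiffAt_inChart_self (hx.smoothAt hp)
  have hls := contDiffAt_scalar_inChart hl
  have hlp : (l ∘ (extChartAt (𝓡 m) p).symm) (coord p) = l p := by
    rw [Function.comp_apply, coord, extChartAt_to_inv]
  have h := conformalFactor_coneMap (x := inChart x p) hm (mod_cast contDiffAt_infty.mp hxs 3)
    (mod_cast contDiffAt_infty.mp hls 3) (by rwa [hlp])
    ((tendsto_symm_coord p).eventually (hx.eventually_one hp)) (hx.det_ne_zero hp) hν.1
    (by rw [inChart_coord]; exact hν.2.1) (hx.pinner_pd hp hν)
  rw [hlp] at h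
  have h' : pinner 2 (selfLaplacian m (coneMap l x) p) (selfLaplacian m (coneMap l x) p) -
      (m : ℝ) ^ 2 * inducedKappa m (coneMap l x) p = -((l p ^ 2)⁻¹ * rhoSq x p ν) := h
  rw [conformalMetric, h', inducedForm_coneMap hl (hx.smoothAt hp) (hx.eventually_one hp)]
  field_simp

omit hx hp hl in
lemma pinner_pos_diff (hx : IsSpacelikeInDeSitter x V) (hp : p ∈ V) (v : TangentSpace (𝓡 m) p) :
    pinner 1 (x p) (diff x p v) = 0 := by
  refine (congrArg (pinner 1 (x p)) (diff_eq_sum_pd (hx.smoothAt hp) v)).trans ?_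
  have := pinner_pd_self ((contDiffAt_inChart_self (hx.smoothAt hp)).differentiableAt (by simp))
    ((tendsto_symm_coord p).eventually (hx.eventually_one hp))
  rw [inChart_coord] at this
  simp [pinner_sum_right, this]

lemma diff_coneMap (v : EuclideanSpace ℝ (Fin m)) : ∃ c : ℝ, diff (m := m) (coneMap l x) p v =
    l p • Matrix.vecCons 0 (diff (m := m) x p v) + c • Matrix.vecCons 1 (x p) := by
  have hxs := contDiffAt_inChart_self (hx.smoothAt hp)
  have hls := contDiffAt_scalar_inChart hl
  have hlp : (l ∘ (extChartAt (𝓡 m) p).symm) (coord p) = l p := by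
    rw [Function.comp_apply, coord, extChartAt_to_inv]
  have h1 : diff (m := m) (coneMap l x) p v = _ :=
    diff_eq_sum_pd (smoothAt_coneMap hl (hx.smoothAt hp)) v
  have h2 : diff (m := m) x p v = _ := diff_eq_sum_pd (hx.smoothAt hp) v
  have h3 : ∀ k, pd k (inChart (m := m) (coneMap l x) p) (coord p) = _ := fun k =>
    pd_coneMap (hxs.differentiableAt (by simp)) (hls.differentiableAt (by simp)) k
  rw [hlp, inChart_coord] at h3
  refine ⟨∑ k, v k *
    pd k (l ∘ (extChartAt (𝓡 m) p).symm) (coord p), ?_⟩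
  rw [h1, h2]
  simp only [h3, smul_add, Finset.sum_add_distrib, Finset.sum_smul, smul_smul]
  congr 1
  ext j
  refine Fin.cases ?_ (fun j => ?_) j
  · simp
  · simp [Finset.mul_sum, mul_assoc, mul_left_comm]

/-- A vector `a (1, x) + (0, ν)` with `ν` normal to `x` is orthogonal to `N` exactly if `a = -H`. -/
lemma pinner_vectorN_coneMap (hm : m ≠ 0) (hl0 : l p ≠ 0) (hν : IsUnitNormalAt x p ν) (a : ℝ) :
    pinner 2 (Matrix.vecCons a (a • x p + ν)) (vectorN m (coneMap l x) p) =
      (l p)⁻¹ * (a + meanCurvature x p ν) := by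
  have hm' : (m : ℝ) ≠ 0 := Nat.cast_ne_zero.mpr hm
  have hxs := contDiffAt_inChart_self (hx.smoothAt hp)
  have hls := contDiffAt_scalar_inChart hl
  have hlp : (l ∘ (extChartAt (𝓡 m) p).symm) (coord p) = l p := by
    rw [Function.comp_apply, coord, extChartAt_to_inv]
  have h := pinner_laplacian_coneMap (x := inChart x p) (mod_cast contDiffAt_infty.mp hxs 2)
    (mod_cast contDiffAt_infty.mp hls 2) (by rwa [hlp])
    ((tendsto_symm_coord p).eventually (hx.eventually_one hp)) (hx.det_ne_zero hp) (ν := ν)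
    (by rw [inChart_coord]; exact hν.2.1) (hx.pinner_pd hp hν) a
  rw [hlp, inChart_coord] at h
  have h' : pinner 2 (Matrix.vecCons a (a • x p + ν)) (selfLaplacian m (coneMap l x) p) =
      -(l p)⁻¹ * (m * a + trace₂ (metricCoeff 1 (inChart x p) (coord p))⁻¹
        (sff (inChart x p) ν (coord p))) := h
  have h0 : pinner 2 (Matrix.vecCons a (a • x p + ν)) (coneMap l x p) = 0 := by
    rw [coneMap, pinner_smul_right, pinner_two_vecCons, pinner_add_left, pinner_smul_left,
      hx.mem_deSitter p hp, hν.2.1]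
    ring
  have hH : meanCurvature x p ν = 1 / (m : ℝ) * trace₂ (metricCoeff 1 (inChart x p) (coord p))⁻¹
        (sff (inChart x p) ν (coord p)) := rfl
  rw [vectorN, pinner_sub_right, pinner_smul_right, pinner_smul_right, h0, h', hH,
    mul_zero, sub_zero]
  field_simp

end IsSpacelikeInDeSitter

end Cone

section Rep

variable {m : ℕ}

/-- The linear isometry of `ℝ₂ᵐ⁺³` exchanging the first and the `α`-th time-like coordinate. -/
def timeSwap (m : ℕ) (α : Fin 2) : (Fin (m + 3) → ℝ) ≃L[ℝ] (Fin (m + 3) → ℝ) :=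
  (LinearEquiv.funCongrLeft ℝ ℝ (Equiv.swap 0 (timeIndex m α))).toContinuousLinearEquiv

lemma timeSwap_apply (α : Fin 2) (v : Fin (m + 3) → ℝ) (i : Fin (m + 3)) :
    timeSwap m α v i = v (Equiv.swap 0 (timeIndex m α) i) := rfl

lemma timeSwap_timeSwap (α : Fin 2) (v : Fin (m + 3) → ℝ) : timeSwap m α (timeSwap m α v) = v := by
  ext i
  simp [timeSwap_apply]

lemma pinner_timeSwap (α : Fin 2) (v w : Fin (m + 3) → ℝ) :
    pinner 2 (timeSwap m α v) (timeSwap m α w) = pinner 2 v w := by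
  unfold pinner
  refine Fintype.sum_equiv (Equiv.swap 0 (timeIndex m α)) _ _ fun i => ?_
  simp only [timeSwap_apply]
  congr 1
  have hτ : ((timeIndex m α : Fin (m + 3)) : ℕ) < 2 := α.2
  rcases eq_or_ne i 0 with rfl | h0
  · rw [Equiv.swap_apply_left, if_pos hτ, if_pos (by simp)]
  rcases eq_or_ne i (timeIndex m α) with rfl | h1
  · rw [Equiv.swap_apply_right, if_pos hτ, if_pos (by simp)]
  · rw [Equiv.swap_apply_of_ne_of_ne h0 h1]

lemma pinner_timeSwap_left (α : Fin 2) (v w : Fin (m + 3) → ℝ) :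
    pinner 2 (timeSwap m α v) w = pinner 2 v (timeSwap m α w) := by
  rw [← pinner_timeSwap α v, timeSwap_timeSwap]

/-- Inserting `a` at the `α`-th time-like place is inserting it in front and then exchanging. -/
lemma timeSwap_vecCons (α : Fin 2) (v : Fin (m + 3) → ℝ) :
    timeSwap m α (Matrix.vecCons (v (timeIndex m α)) fun i => v ((timeIndex m α).succAbove i)) =
      v := by
  ext i
  rw [timeSwap_apply]
  fin_cases α
  · have h : timeIndex m ⟨0, by omega⟩ = 0 := rfl
    simp only [h, Equiv.swap_self, Equiv.refl_apply]
    refine Fin.cases ?_ (fun j => ?_) i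
    · rfl
    · simp
  · have h : timeIndex m ⟨1, by omega⟩ = Fin.succ 0 := rfl
    simp only [h]
    refine Fin.cases ?_ (fun j => Fin.cases ?_ (fun j => ?_) j) i
    · rw [Equiv.swap_apply_left]
      simp
    · rw [Equiv.swap_apply_right]
      simp
    · rw [Equiv.swap_apply_of_ne_of_ne (Fin.succ_ne_zero _)
        (fun h => Fin.succ_ne_zero _ (Fin.succ_injective _ h))]
      simp

/-- A sign times `timeSwap` is again a linear isometry. -/
lemma exists_signed_timeSwap (α : Fin 2) {ε : ℝ} (hε : ε = 1 ∨ ε = -1) :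
    ∃ L : (Fin (m + 3) → ℝ) ≃L[ℝ] (Fin (m + 3) → ℝ),
      (∀ v, L v = ε • timeSwap m α v) ∧ ∀ a b, pinner 2 (L a) (L b) = pinner 2 a b := by
  rcases hε with rfl | rfl
  · exact ⟨timeSwap m α, fun v => (one_smul _ _).symm, pinner_timeSwap α⟩
  · refine ⟨(timeSwap m α).trans (ContinuousLinearEquiv.neg ℝ), fun v => ?_, fun a b => ?_⟩
    · simp
    · simp [pinner_timeSwap]

variable {M : Type*} [TopologicalSpace M] [ChartedSpace (EuclideanSpace ℝ (Fin m)) M]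
  {xbar : M → ConformalSpace m} {V : Set M} {y : M → Fin (m + 3) → ℝ} {p : M} {α : Fin 2}

namespace IsLift

lemma mem_submodule (hy : IsLift xbar V y) (hp : p ∈ V) : y p ∈ (xbar p).1.submodule := by
  obtain ⟨h, hq⟩ := hy.lift p hp
  rw [hq, Projectivization.submodule_mk]
  exact Submodule.mem_span_singleton_self _

lemma coord_ne_zero (hy : IsLift xbar V y) (hp : p ∈ V) (hpα : p ∈ repDomain xbar α) :
    y p (timeIndex m α) ≠ 0 :=
  hpα (y p) (hy.mem_submodule hp) (hy.lift p hp).1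

lemma mem_repDomain (hy : IsLift xbar V y) (hp : p ∈ V) (h : y p (timeIndex m α) ≠ 0) :
    p ∈ repDomain xbar α := by
  obtain ⟨h0, hq⟩ := hy.lift p hp
  intro z hz hz0
  rw [hq, Projectivization.submodule_mk] at hz
  obtain ⟨c, rfl⟩ := Submodule.mem_span_singleton.mp hz
  have hc : c ≠ 0 := fun hc => hz0 (by rw [hc, zero_smul])
  exact mul_ne_zero hc h

lemma deSitterRep_eq (hy : IsLift xbar V y) (hp : p ∈ V) :
    deSitterRep xbar α p =
      (y p (timeIndex m α))⁻¹ • fun i => y p ((timeIndex m α).succAbove i) := by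
  obtain ⟨h0, hq⟩ := hy.lift p hp
  unfold deSitterRep coordMap
  rw [hq]
  rfl

/-- A lift is `λ P (1, x)`, with `λ` its `α`-th time-like coordinate. -/
lemma eq_timeSwap (hy : IsLift xbar V y) (hp : p ∈ V) (h : y p (timeIndex m α) ≠ 0) :
    y p = timeSwap m α (coneMap (fun q => y q (timeIndex m α)) (deSitterRep xbar α) p) := by
  conv_lhs => rw [← timeSwap_vecCons α (y p)]
  congr 1
  rw [coneMap, hy.deSitterRep_eq hp]
  ext i
  refine Fin.cases ?_ (fun i => ?_) i
  · simp
  · simp [h]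

lemma smoothAt (hy : IsLift xbar V y) (hV : IsOpen V) (hp : p ∈ V) :
    ContMDiffAt (𝓡 m) 𝓘(ℝ, Fin (m + 3) → ℝ) ∞ y p :=
  hy.smooth.contMDiffAt (hV.mem_nhds hp)

lemma smoothAt_coord (hy : IsLift xbar V y) (hV : IsOpen V) (hp : p ∈ V) (i : Fin (m + 3)) :
    ContMDiffAt (𝓡 m) 𝓘(ℝ, ℝ) ∞ (fun q => y q i) p :=
  contMDiffAt_pi_space.mp (hy.smoothAt hV hp) i

lemma eventually_eq_timeSwap (hy : IsLift xbar V y) (hV : IsOpen V) (hp : p ∈ V)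
    (h : y p (timeIndex m α) ≠ 0) :
    y =ᶠ[nhds p] timeSwap m α ∘ coneMap (fun q => y q (timeIndex m α)) (deSitterRep xbar α) := by
  filter_upwards [hV.mem_nhds hp,
    (hy.smoothAt_coord hV hp (timeIndex m α)).continuousAt.eventually_ne h] with q hq hq0
  exact hy.eq_timeSwap hq hq0

lemma pinner_self (hy : IsLift xbar V y) (hp : p ∈ V) : pinner 2 (y p) (y p) = 0 :=
  (xbar p).2 _ (hy.mem_submodule hp)

lemma mem_deSitter (hy : IsLift xbar V y) (hp : p ∈ V) (h : y p (timeIndex m α) ≠ 0) :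
    pinner 1 (deSitterRep xbar α p) (deSitterRep xbar α p) = 1 := by
  have h0 := hy.pinner_self hp
  rw [hy.eq_timeSwap hp h, pinner_timeSwap, coneMap, pinner_smul_left, pinner_smul_right,
    pinner_two_vecCons, ← mul_assoc] at h0
  have := (mul_eq_zero.mp h0).resolve_left (mul_ne_zero h h)
  linarith

lemma smoothAt_deSitterRep (hy : IsLift xbar V y) (hV : IsOpen V) (hp : p ∈ V)
    (h : y p (timeIndex m α) ≠ 0) :
    ContMDiffAt (𝓡 m) 𝓘(ℝ, Fin (m + 2) → ℝ) ∞ (deSitterRep xbar α) p := by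
  have hf : ContDiffAt ℝ ∞ (fun v : Fin (m + 3) → ℝ => (v (timeIndex m α))⁻¹ •
      fun i : Fin (m + 2) => v ((timeIndex m α).succAbove i)) (y p) :=
    ((contDiff_apply ℝ ℝ _).contDiffAt.inv h).smul
      (contDiffAt_pi.mpr fun i => (contDiff_apply ℝ ℝ _).contDiffAt)
  refine (hf.contMDiffAt.comp p (hy.smoothAt hV hp)).congr_of_eventuallyEq ?_
  filter_upwards [hV.mem_nhds hp] with q hq
  exact hy.deSitterRep_eq hq

end IsLift

variable [IsManifold (𝓡 m) ∞ M]

omit [IsManifold (𝓡 m) ∞ M] in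
lemma isOpen_repDomain (hx : IsRegularSpacelike xbar) : IsOpen (repDomain xbar α) := by
  rw [isOpen_iff_mem_nhds]
  intro p hp
  obtain ⟨V, y, hV, hpV, hy, -, -⟩ := hx p
  filter_upwards [hV.mem_nhds hpV, (hy.smoothAt_coord hV hpV
    (timeIndex m α)).continuousAt.eventually_ne (hy.coord_ne_zero hpV hp)] with q hq hq0
  exact hy.mem_repDomain hq hq0

lemma isSpacelikeInDeSitter_deSitterRep (hx : IsRegularSpacelike xbar) :
    IsSpacelikeInDeSitter (deSitterRep xbar α) (repDomain xbar α) := by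
  have hloc : ∀ p ∈ repDomain xbar α,
      ContMDiffAt (𝓡 m) 𝓘(ℝ, Fin (m + 2) → ℝ) ∞ (deSitterRep xbar α) p ∧
      pinner 1 (deSitterRep xbar α p) (deSitterRep xbar α p) = 1 := by
    intro p hp
    obtain ⟨V, y, hV, hpV, hy, -, -⟩ := hx p
    exact ⟨hy.smoothAt_deSitterRep hV hpV (hy.coord_ne_zero hpV hp),
      hy.mem_deSitter hpV (hy.coord_ne_zero hpV hp)⟩
  refine ⟨isOpen_repDomain hx, fun p hp => (hloc p hp).1.contMDiffWithinAt,
    fun p hp => (hloc p hp).2, fun p hp v hv => ?_⟩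
  obtain ⟨V, y, hV, hpV, hy, hsp, -⟩ := hx p
  have hc := hy.coord_ne_zero hpV hp
  have h := hsp v hv
  rw [inducedForm_clequiv (pinner_timeSwap α) (hy.eventually_eq_timeSwap hV hpV hc),
    inducedForm_coneMap (hy.smoothAt_coord hV hpV _) (hloc p hp).1
      (Filter.mem_of_superset ((isOpen_repDomain hx).mem_nhds hp) fun q hq => (hloc q hq).2)] at h
  exact pos_of_mul_pos_right h (sq_nonneg _)

/-- The invariant `ρ²` is nonzero because the conformal metric, computed from a lift, is `ρ²` times
the first fundamental form. -/
lemma isRegularSpacelikeInDeSitter_deSitterRep (hm : 2 ≤ m) (hx : IsRegularSpacelike xbar) :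
    IsRegularSpacelikeInDeSitter (deSitterRep xbar α) (repDomain xbar α) := by
  have hxs := isSpacelikeInDeSitter_deSitterRep (α := α) hx
  refine ⟨hxs.isOpen, hxs.smooth, hxs.mem_deSitter, hxs.spacelike, fun p hp ν hν => ?_⟩
  refine lt_of_le_of_ne (rhoSq_nonneg hm hxs hp) fun h0 => ?_
  obtain ⟨V, y, hV, hpV, hy, -, hreg⟩ := hx p
  have hc := hy.coord_ne_zero hpV hp
  obtain ⟨v, hv⟩ := exists_tangent_ne_zero (m := m) (by omega) p
  obtain ⟨w, hw⟩ := hreg v hv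
  refine hw ?_
  rw [conformalMetric_clequiv (pinner_timeSwap α) (hy.eventually_eq_timeSwap hV hpV hc),
    hxs.conformalMetric_coneMap hp (hy.smoothAt_coord hV hpV _) hm hc hν, ← h0, zero_mul]

section OnOpenSet

variable {n : M → Fin (m + 2) → ℝ} {Y ξ : M → Fin (m + 3) → ℝ}

/-- The sign relating a canonical lift to the conformal position. -/
def liftSign (α : Fin 2) (Y : M → Fin (m + 3) → ℝ) (p : M) : ℝ :=
  if 0 < Y p (timeIndex m α) then 1 else -1

omit [TopologicalSpace M] [ChartedSpace (EuclideanSpace ℝ (Fin m)) M] [IsManifold (𝓡 m) ∞ M] in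
lemma liftSign_eq (α : Fin 2) (Y : M → Fin (m + 3) → ℝ) (p : M) :
    liftSign α Y p = 1 ∨ liftSign α Y p = -1 := by
  unfold liftSign
  split_ifs <;> simp

omit [IsManifold (𝓡 m) ∞ M] in
lemma IsLift.eventually_liftSign (hY : IsLift xbar V Y) (hV : IsOpen V)
    (hVα : V ⊆ repDomain xbar α) (hp : p ∈ V) :
    ∀ᶠ q in nhds p, liftSign α Y q = liftSign α Y p := by
  have hc := (hY.smoothAt_coord hV hp (timeIndex m α)).continuousAt
  rcases lt_or_gt_of_ne (hY.coord_ne_zero hp (hVα hp)) with h | h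
  · filter_upwards [hc.eventually_lt_const h] with q hq
    rw [liftSign, liftSign, if_neg (not_lt.mpr hq.le), if_neg (not_lt.mpr h.le)]
  · filter_upwards [hc.eventually_const_lt h] with q hq
    rw [liftSign, liftSign, if_pos hq, if_pos h]

variable (hm : 2 ≤ m) (hx : IsRegularSpacelike xbar) (hV : IsOpen V) (hVα : V ⊆ repDomain xbar α)
  (hn : IsUnitNormal (deSitterRep xbar α) V n)
include hm hx hV hVα hn

lemma smoothAt_sqrt_rhoSq (hp : p ∈ V) : ContMDiffAt (𝓡 m) 𝓘(ℝ, ℝ) ∞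
    (fun q => Real.sqrt (rhoSq (deSitterRep xbar α) q (n q))) p := by
  have hxs := (isSpacelikeInDeSitter_deSitterRep (α := α) hx).mono hV hVα
  have hpos := (isRegularSpacelikeInDeSitter_deSitterRep (α := α) hm hx).regular p (hVα hp) _
    (hn.normal p hp)
  exact (Real.contDiffAt_sqrt hpos.ne').contMDiffAt.comp p (contMDiffAt_rhoSq hxs hn hp)

omit hV in
lemma sqrt_rhoSq_pos (hp : p ∈ V) : 0 < Real.sqrt (rhoSq (deSitterRep xbar α) p (n p)) :=
  Real.sqrt_pos.mpr ((isRegularSpacelikeInDeSitter_deSitterRep (α := α) hm hx).regular p (hVα hp) _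
    (hn.normal p hp))

lemma inducedForm_conformalPosition (hp : p ∈ V) (v w : TangentSpace (𝓡 m) p) :
    inducedForm 2 (conformalPosition (deSitterRep xbar α) n) p v w =
      rhoSq (deSitterRep xbar α) p (n p) * inducedForm 1 (deSitterRep xbar α) p v w := by
  have hxs := (isSpacelikeInDeSitter_deSitterRep (α := α) hx).mono hV hVα
  have h := inducedForm_coneMap (smoothAt_sqrt_rhoSq hm hx hV hVα hn hp) (hxs.smoothAt hp)
    (hxs.eventually_one hp) v w
  rwa [Real.sq_sqrt (Real.sqrt_pos.mp (sqrt_rhoSq_pos hm hx hVα hn hp)).le] at h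

lemma conformalMetric_lift (hy : IsLift xbar V y) (hp : p ∈ V) (v w : TangentSpace (𝓡 m) p) :
    conformalMetric y p v w =
      inducedForm 2 (conformalPosition (deSitterRep xbar α) n) p v w := by
  have hxs := (isSpacelikeInDeSitter_deSitterRep (α := α) hx).mono hV hVα
  have hc := hy.coord_ne_zero hp (hVα hp)
  rw [inducedForm_conformalPosition hm hx hV hVα hn hp,
    conformalMetric_clequiv (pinner_timeSwap α) (hy.eventually_eq_timeSwap hV hp hc),
    hxs.conformalMetric_coneMap hp (hy.smoothAt_coord hV hp _) hm hc (hn.normal p hp)]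

lemma isCanonicalLift_conformalPosition : IsCanonicalLift xbar V
    (timeSwap m α ∘ conformalPosition (deSitterRep xbar α) n) := by
  have hxs := (isSpacelikeInDeSitter_deSitterRep (α := α) hx).mono hV hVα
  have hlift : IsLift xbar V (timeSwap m α ∘ conformalPosition (deSitterRep xbar α) n) := by
    refine ⟨fun p hp => ContMDiffAt.contMDiffWithinAt ?_, fun p hp => ?_⟩
    · exact (timeSwap m α).contDiff.contDiffAt.contMDiffAt.comp p
        (smoothAt_coneMap (smoothAt_sqrt_rhoSq hm hx hV hVα hn hp) (hxs.smoothAt hp))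
    · obtain ⟨W, y, -, hpW, hy, -, -⟩ := hx p
      obtain ⟨h0, hmk⟩ := hy.lift p hpW
      have hc := hy.coord_ne_zero hpW (hVα hp)
      have hρ := sqrt_rhoSq_pos hm hx hVα hn hp
      have hY : (timeSwap m α ∘ conformalPosition (deSitterRep xbar α) n) p =
          (Real.sqrt (rhoSq (deSitterRep xbar α) p (n p)) * (y p (timeIndex m α))⁻¹) • y p := by
        have h1 := hy.eq_timeSwap hpW hc
        rw [coneMap, map_smul, ← inv_smul_eq_iff₀ hc] at h1
        rw [Function.comp_apply, conformalPosition, map_smul, mul_smul, h1]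
      have hne : (Real.sqrt (rhoSq (deSitterRep xbar α) p (n p)) * (y p (timeIndex m α))⁻¹) ≠ 0 :=
        mul_ne_zero hρ.ne' (inv_ne_zero hc)
      refine ⟨by rw [hY]; exact smul_ne_zero hne h0, ?_⟩
      rw [hmk, Projectivization.mk_eq_mk_iff']
      refine ⟨(Real.sqrt (rhoSq (deSitterRep xbar α) p (n p)) * (y p (timeIndex m α))⁻¹)⁻¹, ?_⟩
      rw [hY, smul_smul, inv_mul_cancel₀ hne, one_smul]
  refine ⟨hlift, fun p hp v w => ?_⟩
  rw [conformalMetric_lift hm hx hV hVα hn hlift hp,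
    inducedForm_clequiv (pinner_timeSwap α) (Filter.EventuallyEq.refl _ _)]

/-- A canonical lift is, up to a locally constant sign and the exchange of coordinates, the
conformal position. -/
lemma canonicalLift_eq (hY : IsCanonicalLift xbar V Y) (hp : p ∈ V) :
    Y p = liftSign α Y p • timeSwap m α (conformalPosition (deSitterRep xbar α) n p) := by
  have hxs := (isSpacelikeInDeSitter_deSitterRep (α := α) hx).mono hV hVα
  have hc := hY.coord_ne_zero hp (hVα hp)
  obtain ⟨v, hv⟩ := exists_tangent_ne_zero (m := m) (by omega) p
  have hpos := hxs.spacelike p hp v hv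
  have h := hY.canonical p hp v v
  rw [conformalMetric_lift hm hx hV hVα hn hY.toIsLift hp,
    inducedForm_conformalPosition hm hx hV hVα hn hp,
    inducedForm_clequiv (pinner_timeSwap α) (hY.eventually_eq_timeSwap hV hp hc),
    inducedForm_coneMap (hY.smoothAt_coord hV hp _) (hxs.smoothAt hp) (hxs.eventually_one hp)] at h
  have hsq := mul_right_cancel₀ hpos.ne' h
  have hsqrt : Real.sqrt (rhoSq (deSitterRep xbar α) p (n p)) = |Y p (timeIndex m α)| := by
    rw [← hsq, Real.sqrt_sq_eq_abs]
  have hsign : Y p (timeIndex m α) =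
      liftSign α Y p * Real.sqrt (rhoSq (deSitterRep xbar α) p (n p)) := by
    rw [hsqrt, liftSign]
    split_ifs with h0
    · rw [abs_of_pos h0, one_mul]
    · rw [abs_of_nonpos (not_lt.mp h0)]
      ring
  conv_lhs => rw [hY.eq_timeSwap hp hc]
  simp only [conformalPosition, coneMap, map_smul, smul_smul]
  rw [← hsign]

/-- Locally a canonical lift is the image of the conformal position under a linear isometry. -/
lemma exists_isometry (hY : IsCanonicalLift xbar V Y) (hp : p ∈ V) :
    ∃ L : (Fin (m + 3) → ℝ) ≃L[ℝ] (Fin (m + 3) → ℝ),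
      (∀ v, L v = liftSign α Y p • timeSwap m α v) ∧
      (∀ a b, pinner 2 (L a) (L b) = pinner 2 a b) ∧
      Y =ᶠ[nhds p] L ∘ conformalPosition (deSitterRep xbar α) n := by
  obtain ⟨L, hLv, hL⟩ := exists_signed_timeSwap (m := m) α (liftSign_eq α Y p)
  refine ⟨L, hLv, hL, ?_⟩
  filter_upwards [hV.mem_nhds hp, hY.eventually_liftSign hV hVα hp] with q hq hε
  rw [canonicalLift_eq hm hx hV hVα hn hY hq, hε, Function.comp_apply, hLv]

omit hm in
lemma smoothAt_deSitterXi (hp : p ∈ V) : ContMDiffAt (𝓡 m) 𝓘(ℝ, Fin (m + 3) → ℝ) ∞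
    (deSitterXi (deSitterRep xbar α) n) p := by
  have hxs := (isSpacelikeInDeSitter_deSitterRep (α := α) hx).mono hV hVα
  have hH := (contMDiffAt_meanCurvature hxs hn hp).neg
  exact smoothAt_vecCons hH ((hH.smul (hxs.smoothAt hp)).add (hn.smoothAt hV hp))

/-- The field `ξ` of the de Sitter representative becomes a conformal normal field of a canonical
lift. -/
lemma isConformalNormal_deSitterXi (hY : IsCanonicalLift xbar V Y) : IsConformalNormal V Y
    fun p => liftSign α Y p • timeSwap m α (deSitterXi (deSitterRep xbar α) n p) := by
  have hxs := (isSpacelikeInDeSitter_deSitterRep (α := α) hx).mono hV hVα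
  have hself : ∀ p ∈ V, pinner 2 (deSitterXi (deSitterRep xbar α) n p)
      (deSitterXi (deSitterRep xbar α) n p) = -1 ∧
      pinner 2 (deSitterXi (deSitterRep xbar α) n p)
        (Matrix.vecCons 1 (deSitterRep xbar α p)) = 0 := by
    intro p hp
    obtain ⟨h1, h2, -⟩ := hn.normal p hp
    have h3 := hxs.mem_deSitter p hp
    simp only [deSitterXi, pinner_two_vecCons, pinner_add_left, pinner_add_right,
      pinner_smul_left, pinner_smul_right, h1, h2, h3, pinner_comm _ (n p)]
    constructor <;> ring
  refine ⟨fun p hp => ContMDiffAt.contMDiffWithinAt ?_, fun p hp => ?_, fun p hp => ?_,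
    fun p hp => ?_, fun p hp v => ?_⟩
  · obtain ⟨L, hLv, hL, -⟩ := exists_isometry hm hx hV hVα hn hY hp
    refine (L.contDiff.contDiffAt.contMDiffAt.comp p
      (smoothAt_deSitterXi hx hV hVα hn hp)).congr_of_eventuallyEq ?_
    filter_upwards [hY.eventually_liftSign hV hVα hp] with q hε
    rw [hε, ← hLv]
    rfl
  all_goals
    obtain ⟨L, hLv, hL, hYL⟩ := exists_isometry hm hx hV hVα hn hY hp
    simp only [← hLv]
  · rw [hL, (hself p hp).1]
  · rw [hYL.eq_of_nhds, Function.comp_apply, hL, conformalPosition, pinner_smul_right,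
      (hself p hp).2, mul_zero]
  · rw [vectorN_clequiv hL hYL, hL]
    have h := hxs.pinner_vectorN_coneMap hp (smoothAt_sqrt_rhoSq hm hx hV hVα hn hp) (by omega)
      (sqrt_rhoSq_pos hm hx hVα hn hp).ne' (hn.normal p hp)
      (-meanCurvature (deSitterRep xbar α) p (n p))
    rw [neg_add_cancel, mul_zero] at h
    exact h
  · rw [diff_clequiv hYL, hL]
    obtain ⟨c, hd⟩ := hxs.diff_coneMap hp (smoothAt_sqrt_rhoSq hm hx hV hVα hn hp) v
    have h2 := (hn.normal p hp).2.2 v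
    have h3 := hxs.pinner_pos_diff hp v
    refine (congrArg (pinner 2 (deSitterXi (deSitterRep xbar α) n p)) hd).trans ?_
    rw [pinner_add_right, pinner_smul_right, pinner_smul_right, (hself p hp).2, deSitterXi,
      pinner_two_vecCons, pinner_add_left, pinner_smul_left]
    erw [h2, h3]
    ring

end OnOpenSet

/-- A conformal normal field of a canonical lift comes from a unit normal field of the de Sitter
representative: its component along `(1, x)` is minus the mean curvature because it is orthogonal
to `N`. -/
lemma exists_isUnitNormal_of_isConformalNormal {Y ξ : M → Fin (m + 3) → ℝ} (hm : 2 ≤ m)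
    (hx : IsRegularSpacelike xbar) (hV : IsOpen V) (hVα : V ⊆ repDomain xbar α)
    (hY : IsCanonicalLift xbar V Y) (hξ : IsConformalNormal V Y ξ) :
    ∃ n, IsUnitNormal (deSitterRep xbar α) V n ∧ ∀ p ∈ V,
      ξ p = liftSign α Y p • timeSwap m α (deSitterXi (deSitterRep xbar α) n p) := by
  have hxs := (isSpacelikeInDeSitter_deSitterRep (α := α) hx).mono hV hVα
  set x := deSitterRep xbar α with hxdef
  let w : M → Fin (m + 2 + 1) → ℝ := fun p => liftSign α Y p • timeSwap m α (ξ p)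
  let n : M → Fin (m + 2) → ℝ := fun p => Matrix.vecTail (w p) - w p 0 • x p
  have hw : ∀ p, w p = Matrix.vecCons (w p 0) (w p 0 • x p + n p) := by
    intro p
    have : w p 0 • x p + n p = Matrix.vecTail (w p) := by simp [n]
    rw [this]
    exact (Matrix.cons_head_tail (w p)).symm
  have hε : ∀ p, liftSign α Y p * liftSign α Y p = 1 := by
    intro p
    rcases liftSign_eq α Y p with h | h <;> rw [h] <;> norm_num
  have hε0 : ∀ p, liftSign α Y p ≠ 0 := fun p => left_ne_zero_of_mul_eq_one (hε p)
  have hξw : ∀ p, ξ p = liftSign α Y p • timeSwap m α (w p) := by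
    intro p
    simp only [w, map_smul, smul_smul, hε, one_smul, timeSwap_timeSwap]
  have hcone : ∀ p ∈ V, Y =ᶠ[nhds p]
      timeSwap m α ∘ coneMap (fun q => Y q (timeIndex m α)) x := fun p hp =>
    hY.eventually_eq_timeSwap hV hp (hY.coord_ne_zero hp (hVα hp))
  -- Orthogonality of `ξ` to the image of `z` under the exchange of coordinates.
  have htrans : ∀ p z, pinner 2 (ξ p) (timeSwap m α z) = 0 → pinner 2 (w p) z = 0 := by
    intro p z h
    simp only [w, pinner_smul_left, pinner_timeSwap_left, h, mul_zero]
  have hwX : ∀ p ∈ V, pinner 2 (w p) (Matrix.vecCons 1 (x p)) = 0 := by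
    intro p hp
    have h := hξ.orth_Y p hp
    rw [(hcone p hp).eq_of_nhds] at h
    have h' := htrans p _ h
    rw [coneMap, pinner_smul_right] at h'
    exact (mul_eq_zero.mp h').resolve_left (hY.coord_ne_zero hp (hVα hp))
  have hnx : ∀ p ∈ V, pinner 1 (n p) (x p) = 0 := by
    intro p hp
    have h := hwX p hp
    rw [hw p, pinner_two_vecCons, pinner_add_left, pinner_smul_left, hxs.mem_deSitter p hp] at h
    linarith
  have hnormal : ∀ p ∈ V, IsUnitNormalAt x p (n p) := by
    intro p hp
    refine ⟨?_, hnx p hp, fun v => ?_⟩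
    · have h := hξ.unit p hp
      rw [hξw p, pinner_smul_left, pinner_smul_right, pinner_timeSwap, ← mul_assoc, hε, one_mul,
        hw p, pinner_two_vecCons] at h
      simp only [pinner_add_left, pinner_add_right, pinner_smul_left, pinner_smul_right,
        hxs.mem_deSitter p hp, pinner_comm (x p) (n p), hnx p hp] at h
      linarith
    · have h := hξ.orth_dY p hp v
      rw [diff_clequiv (hcone p hp)] at h
      obtain ⟨c, hd⟩ := hxs.diff_coneMap hp (hY.smoothAt_coord hV hp (timeIndex m α)) v
      have h' := (congrArg (pinner 2 (w p)) hd).symm.trans (htrans p _ h)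
      rw [pinner_add_right, pinner_smul_right, pinner_smul_right, hwX p hp, mul_zero,
        add_zero] at h'
      have h2 := (mul_eq_zero.mp h').resolve_left (hY.coord_ne_zero hp (hVα hp))
      have h3 : pinner 1 (x p) (diff (m := m) x p v) = 0 := hxs.pinner_pos_diff hp v
      rw [hw p, pinner_two_vecCons, pinner_add_left, pinner_smul_left, h3] at h2
      have : pinner 1 (n p) (diff (m := m) x p v) = 0 := by linarith
      exact this
  refine ⟨n, ⟨fun p hp => ContMDiffAt.contMDiffWithinAt ?_, hnormal⟩, fun p hp => ?_⟩
  · have hws : ContMDiffAt (𝓡 m) 𝓘(ℝ, Fin (m + 3) → ℝ) ∞ w p := by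
      have hξs : ContMDiffAt (𝓡 m) 𝓘(ℝ, Fin (m + 3) → ℝ) ∞ ξ p :=
        hξ.smooth.contMDiffAt (hV.mem_nhds hp)
      have h1 : ContDiff ℝ ∞ fun z => liftSign α Y p • timeSwap m α z :=
        (timeSwap m α).contDiff.const_smul _
      refine (h1.contDiffAt.contMDiffAt.comp p hξs).congr_of_eventuallyEq ?_
      filter_upwards [hY.eventually_liftSign hV hVα hp] with q hq
      simp only [w, hq, Function.comp_apply]
    rw [contMDiffAt_pi_space] at hws
    exact (contMDiffAt_pi_space.mpr fun i => hws i.succ).sub ((hws 0).smul (hxs.smoothAt hp))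
  · have h := hξ.orth_N p hp
    rw [vectorN_clequiv (pinner_timeSwap α) (hcone p hp)] at h
    have h' := htrans p _ h
    have hc := hY.coord_ne_zero hp (hVα hp)
    rw [hw p, hxs.pinner_vectorN_coneMap hp (hY.smoothAt_coord hV hp (timeIndex m α)) (by omega) hc
      (hnormal p hp)] at h'
    have ha : w p 0 = -meanCurvature x p (n p) :=
      eq_neg_of_add_eq_zero_left ((mul_eq_zero.mp h').resolve_left (inv_ne_zero hc))
    rw [hξw p, hw p, ha]
    rfl

end Rep

end ConformalGeometry

end

open ConformalGeometry in
theorem corollary2p2 {m : ℕ} (hm : 2 ≤ m) {M : Type*} [TopologicalSpace M]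
    [ChartedSpace (EuclideanSpace ℝ (Fin m)) M] [IsManifold (𝓡 m) ∞ M]
    (xbar : M → ConformalSpace m) (hx : IsRegularSpacelike xbar) (α : Fin 2) :
    -- the representative is a regular space-like hypersurface, and it has a unit normal field
    IsRegularSpacelikeInDeSitter (deSitterRep xbar α) (repDomain xbar α) ∧
    (∃ n, IsUnitNormal (deSitterRep xbar α) (repDomain xbar α) n) ∧
    ∀ V : Set M, IsOpen V → V ⊆ repDomain xbar α →
      (∀ n, IsUnitNormal (deSitterRep xbar α) V n →
        -- the conformal metrics coincide
        (∀ y, IsLift xbar V y → ∀ p ∈ V, ∀ v w : TangentSpace (𝓡 m) p,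
          conformalMetric y p v w =
            inducedForm 2 (conformalPosition (deSitterRep xbar α) n) p v w) ∧
        -- canonical lifts exist, and for each of them the other invariants coincide
        (∃ Y, IsCanonicalLift xbar V Y) ∧
        ∀ Y, IsCanonicalLift xbar V Y →
          (∀ p ∈ V, ∀ v w : TangentSpace (𝓡 m) p,
            blaschkeTensor Y p v w =
              blaschkeTensor (conformalPosition (deSitterRep xbar α) n) p v w) ∧
          ∃ ξ, IsConformalNormal V Y ξ ∧ ∀ p ∈ V,
            (∀ v : TangentSpace (𝓡 m) p, conformalForm Y ξ p v =
              conformalForm (conformalPosition (deSitterRep xbar α) n)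
                (deSitterXi (deSitterRep xbar α) n) p v) ∧
            (∀ v w : TangentSpace (𝓡 m) p, conformalSFF Y ξ p v w =
              conformalSFF (conformalPosition (deSitterRep xbar α) n)
                (deSitterXi (deSitterRep xbar α) n) p v w)) ∧
      -- conversely, every conformal normal field comes from a unit normal field
      (∀ Y ξ, IsCanonicalLift xbar V Y → IsConformalNormal V Y ξ →
        ∃ n, IsUnitNormal (deSitterRep xbar α) V n ∧ ∀ p ∈ V,
          (∀ v : TangentSpace (𝓡 m) p, conformalForm Y ξ p v =
            conformalForm (conformalPosition (deSitterRep xbar α) n)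
              (deSitterXi (deSitterRep xbar α) n) p v) ∧
          (∀ v w : TangentSpace (𝓡 m) p, conformalSFF Y ξ p v w =
            conformalSFF (conformalPosition (deSitterRep xbar α) n)
              (deSitterXi (deSitterRep xbar α) n) p v w)) := by
  have hreg := isRegularSpacelikeInDeSitter_deSitterRep (α := α) hm hx
  refine ⟨hreg, exists_isUnitNormal (isSpacelikeInDeSitter_deSitterRep hx),
    fun V hV hVα => ⟨?_, ?_⟩⟩
  · intro n hn
    refine ⟨fun y hy p hp v w => conformalMetric_lift hm hx hV hVα hn hy hp v w,
      ⟨_, isCanonicalLift_conformalPosition hm hx hV hVα hn⟩, fun Y hY => ⟨fun p hp v w => ?_,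
      _, isConformalNormal_deSitterXi hm hx hV hVα hn hY, fun p hp => ⟨fun v => ?_, fun v w => ?_⟩⟩⟩
    all_goals obtain ⟨L, hLv, hL, hYL⟩ := exists_isometry hm hx hV hVα hn hY hp
    · exact blaschkeTensor_clequiv hL hYL v w
    · exact conformalForm_clequiv hL hYL (hLv _).symm v
    · exact conformalSFF_clequiv hL hYL (hLv _).symm v w
  · intro Y ξ hY hξ
    obtain ⟨n, hn, hξn⟩ := exists_isUnitNormal_of_isConformalNormal hm hx hV hVα hY hξ
    refine ⟨n, hn, fun p hp => ?_⟩
    obtain ⟨L, hLv, hL, hYL⟩ := exists_isometry hm hx hV hVα hn hY hp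
    have hξL := (hξn p hp).trans (hLv _).symm
    exact ⟨conformalForm_clequiv hL hYL hξL, conformalSFF_clequiv hL hYL hξL⟩
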